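/- Let $p>1$ and let $V:\mathbb{R}^n\to\mathbb{R}$ be even, strictly convex and $p$-homogeneous, i.e. $V(cx)=c^pV(x)$ for all $c>0$ and $x\in\mathbb{R}^n$. Assume that $V$ is $C^2$, or, more generally, that $V$ is $C^1$ on $\mathbb{R}^n$ and $C^2$ on $\{x: x_i\neq 0 \text{ for all } i\}$. Assume that $V$ is unconditional, i.e. $V(\pm x_1,\dots,\pm x_n)=V(x_1,\dots,x_n)$ for every choice of signs, and that the function $$x=(x_1,\dots,x_n)\mapsto V\bigl(x_1^{1/p},\dots,x_n^{1/p}\bigr)$$ is concave on $\mathbb{R}^n_+=\{x: x_i\ge 0 \text{ for all } i\}$. For a proper convex function $\Phi:\mathbb{R}^n\to(-\infty,+\infty]$ let $\Phi^*(y)=\sup_{x}\bigl(\langle x,y\rangle-\Phi(x)\bigr)$ be its Legendre transform, and consider the inequality $$\int_{\mathbb{R}^n} e^{-\Phi(x)}\,dx\,\left(\int_{\mathbb{R}^n} e^{-\frac{1}{p-1}\Phi^*(\nabla V(y))}\,dy\right)^{p-1}\le\left(\int_{\mathbb{R}^n} e^{-V(x)}\,dx\right)^{p}, \qquad (*)$$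 where the integrals take values in $[0,\infty]$ and $0\cdot\infty=0$. 1. Inequality $(*)$ holds for every unconditional proper convex $\Phi$. 2. Assume, in addition, that for every coordinate vector $e=e_i$ and every $x'\in\mathbb{R}^n$ with $x'_i=0$ the function $$\varphi(t)=\det D^2V^*(x'+te)$$ is decreasing (in the wide sense) on the set of those $t\in[0,\infty)$ for which the Legendre transform $V^*$ is twice differentiable at $x'+te$. Then $(*)$ holds for every even proper convex $\Phi$. -/

import Mathlib

open MeasureTheory Set
open scoped ENNReal Gradient

noncomputable section

/-- `Φ : ℝⁿ → (-∞, +∞]` is a proper convex function. -/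
structure IsProperConvex {n : ℕ} (Φ : EuclideanSpace ℝ (Fin n) → EReal) : Prop where
  ne_bot : ∀ x, Φ x ≠ ⊥
  exists_ne_top : ∃ x, Φ x ≠ ⊤
  convex : ∀ x y : EuclideanSpace ℝ (Fin n), ∀ a b : ℝ, 0 < a → 0 < b → a + b = 1 →
    Φ (a • x + b • y) ≤ (a : EReal) * Φ x + (b : EReal) * Φ y

/-- Invariance under every change of signs of the coordinates:
`f (±x₁, …, ±xₙ) = f (x₁, …, xₙ)`. -/
def IsUnconditional {n : ℕ} {β : Type*} (f : EuclideanSpace ℝ (Fin n) → β) : Prop :=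
  ∀ x y : EuclideanSpace ℝ (Fin n), (∀ i, |x i| = |y i|) → f x = f y

/-- The Legendre transform `Φ*(y) = sup_x (⟨x, y⟩ - Φ x)`. -/
def legendre {n : ℕ} (Φ : EuclideanSpace ℝ (Fin n) → EReal)
    (y : EuclideanSpace ℝ (Fin n)) : EReal :=
  ⨆ x : EuclideanSpace ℝ (Fin n), ((inner ℝ x y : ℝ) : EReal) - Φ x

/-- The Legendre transform of a real function as a real function (faithful where the
supremum is finite, as it is everywhere for a superlinear function). -/
def legendreReal {n : ℕ} (V : EuclideanSpace ℝ (Fin n) → ℝ)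
    (y : EuclideanSpace ℝ (Fin n)) : ℝ :=
  (legendre (fun x => (V x : EReal)) y).toReal

/-- `f` is twice differentiable at `x`, for a function `f` that is differentiable
around `x`. -/
def HasHessianAt {n : ℕ} (f : EuclideanSpace ℝ (Fin n) → ℝ)
    (x : EuclideanSpace ℝ (Fin n)) : Prop :=
  DifferentiableAt ℝ (∇ f) x

/-- `det D²f(x)`, the determinant of the derivative of the gradient. -/
def hessianDet {n : ℕ} (f : EuclideanSpace ℝ (Fin n) → ℝ)
    (x : EuclideanSpace ℝ (Fin n)) : ℝ :=
  (fderiv ℝ (∇ f) x).det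

/-- The functional `∫ e^{-Φ(x)} dx · (∫ e^{-Φ*(∇V(y)) / (p - 1)} dy)^{p - 1}`
with values in `[0, ∞]`. -/
def blaschkeSantalo {n : ℕ} (p : ℝ) (V : EuclideanSpace ℝ (Fin n) → ℝ)
    (Φ : EuclideanSpace ℝ (Fin n) → EReal) : ℝ≥0∞ :=
  (∫⁻ x, EReal.exp (-Φ x)) *
    (∫⁻ y, EReal.exp (-(((1 / (p - 1) : ℝ) : EReal) * legendre Φ (∇ V y)))) ^ (p - 1)

end

/-!
Put the two inequalities in coordinates and write `D = ∇ V`. By homogeneity the concavity hypothesis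
says that `x ↦ V (x ^ (1 / p) * y ^ (1 - 1 / p))` is concave on the positive orthant, so it lies
below its tangent at `x = y`, which is `x ↦ ⟪x, D y⟫ / p` by Euler's identity. If
`F x * G z ≤ exp (-⟪x, z⟫)` and `F`, `G` are unconditional, then the multiplicative form of the
Prékopa–Leindler inequality applied to `F`, `(G ∘ D) ^ (1 / (p - 1))` and `exp (-V)` on the orthant
is the first assertion.

For even `G`, Steiner symmetrization in each coordinate increases both `∫ polarFun G` and
`∫ G ^ (1 / (p - 1)) ω`, where `ω` is the density of the image of Lebesgue measure under `D`,
provided that `ω` decreases in each `|z i|`; after `n` symmetrizations `G` is unconditional. The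
inverse of `D` is `∇ V*`, so `ω = det D² V*` wherever the Jacobian of `D` does not vanish. By
Sard's theorem this is a dense set, and the monotonicity hypothesis on `det D² V*` extends from it
by continuity of the Jacobian of `D`.
-/

/-! ### Brunn–Minkowski and Prékopa–Leindler on the line -/

open scoped Pointwise in
theorem volume_add_volume_le_of_isCompact {A B : Set ℝ} (hA : IsCompact A) (hB : IsCompact B)
    (hA' : A.Nonempty) (hB' : B.Nonempty) : volume A + volume B ≤ volume (A + B) := by
  set α := sSup A
  set β := sInf B
  have hα : α ∈ A := hA.sSup_mem hA'
  have hβ : β ∈ B := hB.sInf_mem hB'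
  have h_disj : AEDisjoint volume ((· + β) '' A) ((α + ·) '' B) := by
    refine measure_mono_null (t := {α + β}) ?_ (by simp)
    rintro _ ⟨⟨x, hx, rfl⟩, y, hy, hxy⟩
    have hxα : x ≤ α := le_csSup hA.bddAbove hx
    have hβy : β ≤ y := csInf_le hB.bddBelow hy
    simp only [mem_singleton_iff] at hxy ⊢
    linarith
  have h_meas : MeasurableSet ((α + ·) '' B) := (hB.image (by fun_prop)).measurableSet
  calc volume A + volume B = volume ((· + β) '' A) + volume ((α + ·) '' B) := by
        simp [image_add_right, image_add_left]
    _ = volume ((· + β) '' A ∪ (α + ·) '' B) :=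
        (measure_union₀ h_meas.nullMeasurableSet h_disj).symm
    _ ≤ volume (A + B) := by
        refine measure_mono (union_subset ?_ ?_)
        · exact image_subset_iff.2 fun x hx => add_mem_add hx hβ
        · exact image_subset_iff.2 fun y hy => add_mem_add hα hy

theorem volume_add_volume_le {A B C : Set ℝ} (hA : MeasurableSet A) (hB : MeasurableSet B)
    (hA' : A.Nonempty) (hB' : B.Nonempty) (hC : ∀ x ∈ A, ∀ y ∈ B, x + y ∈ C) :
    volume A + volume B ≤ volume C := by
  obtain ⟨x₀, hx₀⟩ := hA'
  obtain ⟨y₀, hy₀⟩ := hB'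
  rw [hA.measure_eq_iSup_isCompact, hB.measure_eq_iSup_isCompact]
  simp only [iSup_and']
  refine ENNReal.biSup_add_biSup_le' ⟨∅, by simp⟩ ⟨∅, by simp⟩ fun K hK L hL => ?_
  calc volume K + volume L ≤ volume (insert x₀ K) + volume (insert y₀ L) := by
        gcongr <;> exact subset_insert _ _
    _ ≤ _ := volume_add_volume_le_of_isCompact (hK.2.insert _) (hL.2.insert _)
        (insert_nonempty _ _) (insert_nonempty _ _)
    _ ≤ volume C := by
        refine measure_mono ?_
        rintro _ ⟨x, hx, y, hy, rfl⟩
        exact hC x (insert_subset hx₀ hK.1 hx) y (insert_subset hy₀ hL.1 hy)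

theorem volume_Ioi_inter_ofReal_lt (y : ℝ≥0∞) :
    volume (Ioi 0 ∩ {t : ℝ | ENNReal.ofReal t < y}) = y := by
  induction y with
  | top => simp
  | coe y =>
    have : Ioi 0 ∩ {t : ℝ | ENNReal.ofReal t < y} = Ioo 0 (y : ℝ) := by
      ext t
      exact and_congr_right fun ht =>
        (ENNReal.ofReal_lt_iff_lt_toReal (le_of_lt ht) ENNReal.coe_ne_top)
    rw [this, Real.volume_Ioo, sub_zero, ENNReal.ofReal_coe_nnreal]

section LayerCake

variable {α : Type*} [MeasurableSpace α] {μ : Measure α}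

theorem measurable_measure_ofReal_lt (f : α → ℝ≥0∞) :
    Measurable fun t => μ {x | ENNReal.ofReal t < f x} :=
  Antitone.measurable fun _ _ hst =>
    measure_mono fun _ hx => (ENNReal.ofReal_le_ofReal hst).trans_lt hx

theorem lintegral_eq_lintegral_measure_ofReal_lt [SFinite μ] {f : α → ℝ≥0∞}
    (hf : Measurable f) :
    ∫⁻ x, f x ∂μ = ∫⁻ t in Ioi (0 : ℝ), μ {x | ENNReal.ofReal t < f x} := by
  have h_meas : MeasurableSet {q : α × ℝ | ENNReal.ofReal q.2 < f q.1} :=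
    measurableSet_lt (by fun_prop) (by fun_prop)
  have h_swap := lintegral_lintegral_swap (μ := μ) (ν := volume.restrict (Ioi (0 : ℝ)))
    (f := fun x t => {q : α × ℝ | ENNReal.ofReal q.2 < f q.1}.indicator 1 (x, t))
    (measurable_one.indicator h_meas).aemeasurable
  calc ∫⁻ x, f x ∂μ
      = ∫⁻ x, volume.restrict (Ioi 0) {t : ℝ | ENNReal.ofReal t < f x} ∂μ := by
        refine lintegral_congr fun x => ?_
        rw [Measure.restrict_apply' measurableSet_Ioi, inter_comm, volume_Ioi_inter_ofReal_lt]
    _ = ∫⁻ x, (∫⁻ t in Ioi 0, {q : α × ℝ | ENNReal.ofReal q.2 < f q.1}.indicator 1 (x, t)) ∂μ :=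
        lintegral_congr fun _ => (lintegral_indicator_one (measurable_prodMk_left h_meas)).symm
    _ = _ := h_swap
    _ = _ := lintegral_congr fun _ => lintegral_indicator_one (measurable_prodMk_right h_meas)

theorem lintegral_mul_eq_lintegral_setLIntegral_ofReal_lt [SFinite μ] {k ω : α → ℝ≥0∞}
    (hk : Measurable k) (hω : Measurable ω) :
    ∫⁻ x, k x * ω x ∂μ =
      ∫⁻ t in Ioi (0 : ℝ), ∫⁻ x in {x | ENNReal.ofReal t < ω x}, k x ∂μ := by
  calc ∫⁻ x, k x * ω x ∂μ = ∫⁻ x, ω x ∂μ.withDensity k :=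
        (lintegral_withDensity_eq_lintegral_mul _ hk hω).symm
    _ = _ := lintegral_eq_lintegral_measure_ofReal_lt hω
    _ = _ := lintegral_congr fun t => withDensity_apply _ (measurableSet_lt (by fun_prop) hω)

theorem lintegral_eq_iSup_lintegral_min {f : α → ℝ≥0∞} (hf : Measurable f) :
    ∫⁻ x, f x ∂μ = ⨆ k : ℕ, ∫⁻ x, min (f x) k ∂μ := by
  rw [← lintegral_iSup (f := fun (k : ℕ) x => min (f x) k) (fun k => by fun_prop)
    (fun k l hkl x => min_le_min_left _ (by exact_mod_cast hkl))]
  refine lintegral_congr fun x => ?_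
  rw [← inf_iSup_eq, ENNReal.iSup_natCast, inf_top_eq]

end LayerCake

/-- The measure `μ` satisfies the Prékopa–Leindler inequality with weights `a` and `b`. -/
def IsPrekopaLeindler {E : Type*} [Add E] [SMul ℝ E] [MeasurableSpace E]
    (a b : ℝ) (μ : Measure E) : Prop :=
  ∀ f g h : E → ℝ≥0∞, Measurable f → Measurable g → Measurable h →
    (∀ x y, f x ^ a * g y ^ b ≤ h (a • x + b • y)) →
    (∫⁻ x, f x ∂μ) ^ a * (∫⁻ x, g x ∂μ) ^ b ≤ ∫⁻ x, h x ∂μ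

section Line

variable {a b : ℝ}

theorem rpow_mul_rpow_le_ofReal_mul_add (ha : 0 < a) (hb : 0 < b) (hab : a + b = 1)
    (x y : ℝ≥0∞) : x ^ a * y ^ b ≤ ENNReal.ofReal a * x + ENNReal.ofReal b * y := by
  have hpq : (a⁻¹).HolderConjugate b⁻¹ :=
    Real.holderConjugate_iff.2 ⟨by rw [one_lt_inv₀ ha]; linarith, by simpa using hab⟩
  have h := ENNReal.young_inequality (x ^ a) (y ^ b) hpq
  simpa only [← ENNReal.rpow_mul, mul_inv_cancel₀ ha.ne', mul_inv_cancel₀ hb.ne',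
    ENNReal.rpow_one, ENNReal.ofReal_inv_of_pos ha, ENNReal.ofReal_inv_of_pos hb,
    ENNReal.div_eq_inv_mul, inv_inv] using h

theorem lintegral_add_lintegral_le_of_iSup_eq_one (ha : 0 < a) (hb : 0 < b) (hab : a + b = 1)
    {f g h : ℝ → ℝ≥0∞} (hf : Measurable f) (hg : Measurable g) (hh : Measurable h)
    (hf1 : ⨆ x, f x = 1) (hg1 : ⨆ x, g x = 1)
    (H : ∀ x y, f x ^ a * g y ^ b ≤ h (a • x + b • y)) :
    ENNReal.ofReal a * (∫⁻ x, f x) + ENNReal.ofReal b * (∫⁻ x, g x) ≤ ∫⁻ x, h x := by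
  rw [lintegral_eq_lintegral_measure_ofReal_lt hf, lintegral_eq_lintegral_measure_ofReal_lt hg,
    lintegral_eq_lintegral_measure_ofReal_lt hh,
    ← lintegral_const_mul _ (measurable_measure_ofReal_lt f),
    ← lintegral_const_mul _ (measurable_measure_ofReal_lt g),
    ← lintegral_add_left ((measurable_measure_ofReal_lt f).const_mul _)]
  refine setLIntegral_mono' measurableSet_Ioi fun t _ => ?_
  set s := ENNReal.ofReal t
  have h_scale {c : ℝ} (hc : 0 < c) (A : Set ℝ) :
      ENNReal.ofReal c * volume A = volume ((c⁻¹ * ·) ⁻¹' A) := by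
    rw [Real.volume_preimage_mul_left (inv_ne_zero hc.ne'), inv_inv, abs_of_pos hc]
  have h_nonempty {c : ℝ} (hc : 0 < c) {A : Set ℝ} (hA : A.Nonempty) :
      ((c⁻¹ * ·) ⁻¹' A).Nonempty :=
    hA.preimage (mul_left_surjective₀ (inv_ne_zero hc.ne'))
  rcases lt_or_ge s 1 with hs | hs
  · rw [h_scale ha, h_scale hb]
    have h_meas {k : ℝ → ℝ≥0∞} (hk : Measurable k) (c : ℝ) :
        MeasurableSet ((c⁻¹ * ·) ⁻¹' {x | s < k x}) :=
      (measurableSet_lt measurable_const hk).preimage (measurable_const_mul _)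
    refine volume_add_volume_le (h_meas hf a) (h_meas hg b)
      (h_nonempty ha (lt_iSup_iff.1 (hs.trans_eq hf1.symm)))
      (h_nonempty hb (lt_iSup_iff.1 (hs.trans_eq hg1.symm)))
      fun x (hx : s < f (a⁻¹ * x)) y (hy : s < g (b⁻¹ * y)) => ?_
    calc s = s ^ a * s ^ b := by rw [← ENNReal.rpow_add_of_nonneg _ _ ha.le hb.le, hab,
          ENNReal.rpow_one]
      _ < f (a⁻¹ * x) ^ a * g (b⁻¹ * y) ^ b :=
          ENNReal.mul_lt_mul (ENNReal.rpow_lt_rpow hx ha) (ENNReal.rpow_lt_rpow hy hb)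
      _ ≤ h (x + y) := by
          simpa [mul_inv_cancel_left₀ ha.ne', mul_inv_cancel_left₀ hb.ne'] using
            H (a⁻¹ * x) (b⁻¹ * y)
  · have h_empty {k : ℝ → ℝ≥0∞} (hk : ⨆ x, k x = 1) : {x | s < k x} = ∅ :=
      eq_empty_of_forall_notMem fun x hx => (((le_iSup k x).trans hk.le).trans hs).not_gt hx
    simp [h_empty hf1, h_empty hg1]

theorem lintegral_rpow_mul_lintegral_rpow_le_of_iSup_ne_top (ha : 0 < a) (hb : 0 < b)
    (hab : a + b = 1) {f g h : ℝ → ℝ≥0∞} (hf : Measurable f) (hg : Measurable g)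
    (hh : Measurable h) (hft : ⨆ x, f x ≠ ⊤) (hgt : ⨆ x, g x ≠ ⊤)
    (H : ∀ x y, f x ^ a * g y ^ b ≤ h (a • x + b • y)) :
    (∫⁻ x, f x) ^ a * (∫⁻ x, g x) ^ b ≤ ∫⁻ x, h x := by
  by_cases hf0 : ⨆ x, f x = 0
  · simp [show ∀ x, f x = 0 by simpa using hf0, ha]
  by_cases hg0 : ⨆ x, g x = 0
  · simp [show ∀ x, g x = 0 by simpa using hg0, hb]
  set M := ⨆ x, f x
  set N := ⨆ x, g x
  set C := (M⁻¹) ^ a * (N⁻¹) ^ b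
  have hC0 : C ≠ 0 := mul_ne_zero (by simp [hft, ha.le]) (by simp [hgt, hb.le])
  have hCt : C ≠ ⊤ := ENNReal.mul_ne_top
    (ENNReal.rpow_ne_top_of_nonneg ha.le (ENNReal.inv_ne_top.2 hf0))
    (ENNReal.rpow_ne_top_of_nonneg hb.le (ENNReal.inv_ne_top.2 hg0))
  have h_split (x y : ℝ≥0∞) : (M⁻¹ * x) ^ a * (N⁻¹ * y) ^ b = C * (x ^ a * y ^ b) := by
    rw [ENNReal.mul_rpow_of_nonneg _ _ ha.le, ENNReal.mul_rpow_of_nonneg _ _ hb.le]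
    ring
  refine (ENNReal.mul_le_mul_iff_right hC0 hCt).1 ?_
  calc C * ((∫⁻ x, f x) ^ a * (∫⁻ x, g x) ^ b)
      = (∫⁻ x, M⁻¹ * f x) ^ a * (∫⁻ x, N⁻¹ * g x) ^ b := by
        rw [lintegral_const_mul _ hf, lintegral_const_mul _ hg, h_split]
    _ ≤ ENNReal.ofReal a * (∫⁻ x, M⁻¹ * f x) + ENNReal.ofReal b * (∫⁻ x, N⁻¹ * g x) :=
        rpow_mul_rpow_le_ofReal_mul_add ha hb hab _ _
    _ ≤ ∫⁻ x, C * h x := by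
        refine lintegral_add_lintegral_le_of_iSup_eq_one ha hb hab (by fun_prop) (by fun_prop)
          (by fun_prop) ?_ ?_ fun x y => ?_
        · rw [← ENNReal.mul_iSup, ENNReal.inv_mul_cancel hf0 hft]
        · rw [← ENNReal.mul_iSup, ENNReal.inv_mul_cancel hg0 hgt]
        · rw [h_split]
          exact mul_le_mul_right (H x y) C
    _ = C * ∫⁻ x, h x := lintegral_const_mul _ hh

theorem isPrekopaLeindler_volume_real (ha : 0 < a) (hb : 0 < b) (hab : a + b = 1) :
    IsPrekopaLeindler a b (volume : Measure ℝ) := by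
  intro f g h hf hg hh H
  rw [lintegral_eq_iSup_lintegral_min hf, lintegral_eq_iSup_lintegral_min hg,
    ← ENNReal.orderIsoRpow_apply _ ha, ← ENNReal.orderIsoRpow_apply _ hb,
    OrderIso.map_iSup, OrderIso.map_iSup, ENNReal.iSup_mul]
  refine iSup_le fun k => ?_
  rw [ENNReal.mul_iSup]
  refine iSup_le fun l => ?_
  have h_bdd (f : ℝ → ℝ≥0∞) (k : ℕ) : ⨆ x, min (f x) k ≠ ⊤ :=
    ne_top_of_le_ne_top (ENNReal.natCast_ne_top k) (iSup_le fun x => min_le_right _ _)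
  refine lintegral_rpow_mul_lintegral_rpow_le_of_iSup_ne_top ha hb hab (by fun_prop)
    (by fun_prop) hh (h_bdd f k) (h_bdd g l) fun x y => le_trans ?_ (H x y)
  gcongr <;> exact min_le_left _ _

end Line

/-! ### Prékopa–Leindler for product measures and in logarithmic coordinates -/

section Tensorization

variable {ι : Type*} [DecidableEq ι] {a b : ℝ} {μ : ι → Measure ℝ} [∀ i, SigmaFinite (μ i)]

theorem smul_update_add_smul_update (x y : ι → ℝ) (i : ι) (s t : ℝ) :
    a • Function.update x i s + b • Function.update y i t =
      Function.update (a • x + b • y) i (a • s + b • t) := by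
  rw [Function.update_add, Function.update_smul, Function.update_smul]

theorem IsPrekopaLeindler.lmarginal (hμ : ∀ i, IsPrekopaLeindler a b (μ i))
    {f g h : (ι → ℝ) → ℝ≥0∞} (hf : Measurable f) (hg : Measurable g) (hh : Measurable h)
    (s : Finset ι) (x y : ι → ℝ)
    (H : ∀ x' y', (∀ i ∉ s, x' i = x i) → (∀ i ∉ s, y' i = y i) →
      f x' ^ a * g y' ^ b ≤ h (a • x' + b • y')) :
    (∫⋯∫⁻_s, f ∂μ) x ^ a * (∫⋯∫⁻_s, g ∂μ) y ^ b ≤ (∫⋯∫⁻_s, h ∂μ) (a • x + b • y) := by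
  induction s using Finset.induction generalizing x y with
  | empty => simpa only [lmarginal_empty] using H x y (fun _ _ => rfl) (fun _ _ => rfl)
  | insert i s hi ih =>
    simp only [lmarginal_insert _ hf hi, lmarginal_insert _ hg hi, lmarginal_insert _ hh hi]
    have h_meas {k : (ι → ℝ) → ℝ≥0∞} (hk : Measurable k) (x : ι → ℝ) :
        Measurable fun t => (∫⋯∫⁻_s, k ∂μ) (Function.update x i t) :=
      (hk.lmarginal μ).comp (measurable_update x)
    have h_agree {x x' : ι → ℝ} {t : ℝ} (hx : ∀ j ∉ s, x' j = Function.update x i t j) :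
        ∀ j ∉ insert i s, x' j = x j := fun j hj => by
      rw [Finset.mem_insert, not_or] at hj
      rw [hx j hj.2, Function.update_of_ne hj.1]
    refine hμ i _ _ _ (h_meas hf x) (h_meas hg y) (h_meas hh _) fun t u => ?_
    rw [← smul_update_add_smul_update]
    exact ih _ _ fun x' y' hx hy => H x' y' (h_agree hx) (h_agree hy)

omit [DecidableEq ι] in
theorem IsPrekopaLeindler.pi [Fintype ι] (hμ : ∀ i, IsPrekopaLeindler a b (μ i)) :
    IsPrekopaLeindler a b (Measure.pi μ) := by
  classical
  intro f g h hf hg hh H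
  simpa only [lmarginal_univ] using
    IsPrekopaLeindler.lmarginal hμ hf hg hh Finset.univ 0 0 fun x y _ _ => H x y

end Tensorization

theorem IsPrekopaLeindler.withDensity {E : Type*} [Add E] [SMul ℝ E] [MeasurableSpace E]
    {a b : ℝ} {μ : Measure E} (hμ : IsPrekopaLeindler a b μ) (ha : 0 ≤ a) (hb : 0 ≤ b)
    {w : E → ℝ≥0∞} (hw : Measurable w) (hw_log : ∀ x y, w x ^ a * w y ^ b ≤ w (a • x + b • y)) :
    IsPrekopaLeindler a b (μ.withDensity w) := by
  intro f g h hf hg hh H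
  rw [lintegral_withDensity_eq_lintegral_mul _ hw hf,
    lintegral_withDensity_eq_lintegral_mul _ hw hg, lintegral_withDensity_eq_lintegral_mul _ hw hh]
  refine hμ _ _ _ (hw.mul hf) (hw.mul hg) (hw.mul hh) fun x y => ?_
  calc (w x * f x) ^ a * (w y * g y) ^ b = (w x ^ a * w y ^ b) * (f x ^ a * g y ^ b) := by
        rw [ENNReal.mul_rpow_of_nonneg _ _ ha, ENNReal.mul_rpow_of_nonneg _ _ hb]
        ring
    _ ≤ w (a • x + b • y) * h (a • x + b • y) := mul_le_mul' (hw_log x y) (H x y)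

/-- The measure `2 eˢ ds` on the line; its image under `exp` is the image of Lebesgue measure
under `|·|`. -/
noncomputable def expMeasure : Measure ℝ :=
  volume.withDensity fun s => ENNReal.ofReal (2 * Real.exp s)

instance : SigmaFinite expMeasure :=
  SigmaFinite.withDensity_of_ne_top' fun _ => ENNReal.ofReal_ne_top

theorem isPrekopaLeindler_expMeasure {a b : ℝ} (ha : 0 < a) (hb : 0 < b) (hab : a + b = 1) :
    IsPrekopaLeindler a b expMeasure := by
  refine (isPrekopaLeindler_volume_real ha hb hab).withDensity ha.le hb.le (by fun_prop)
    fun s t => le_of_eq ?_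
  rw [ENNReal.ofReal_rpow_of_pos (by positivity), ENNReal.ofReal_rpow_of_pos (by positivity),
    ← ENNReal.ofReal_mul (by positivity)]
  congr 1
  calc (2 * Real.exp s) ^ a * (2 * Real.exp t) ^ b
      = ((2 : ℝ) ^ a * 2 ^ b) * (Real.exp (s * a) * Real.exp (t * b)) := by
        rw [Real.mul_rpow zero_le_two (Real.exp_pos s).le,
          Real.mul_rpow zero_le_two (Real.exp_pos t).le, Real.exp_mul, Real.exp_mul]
        ring
    _ = 2 * Real.exp (a • s + b • t) := by
        rw [← Real.rpow_add two_pos, hab, Real.rpow_one, ← Real.exp_add, smul_eq_mul,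
          smul_eq_mul, mul_comm s, mul_comm t]

theorem measurePreserving_exp_expMeasure :
    MeasurePreserving Real.exp expMeasure ((2 : NNReal) • volume.restrict (Ioi (0 : ℝ))) := by
  refine ⟨Real.measurable_exp, Measure.ext fun s hs => ?_⟩
  have h_image := lintegral_image_eq_lintegral_abs_deriv_mul (s := Real.exp ⁻¹' s)
    (Real.measurable_exp hs) (fun x _ => (Real.hasDerivAt_exp x).hasDerivWithinAt)
    Real.exp_injective.injOn fun _ => 2
  rw [image_preimage_eq_inter_range, Real.range_exp] at h_image
  rw [Measure.map_apply Real.measurable_exp hs, expMeasure,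
    withDensity_apply _ (Real.measurable_exp hs), Measure.smul_apply, Measure.restrict_apply hs]
  calc ∫⁻ x in Real.exp ⁻¹' s, ENNReal.ofReal (2 * Real.exp x)
      = ∫⁻ x in Real.exp ⁻¹' s, ENNReal.ofReal |Real.exp x| * 2 := by
        simp only [ENNReal.ofReal_mul zero_le_two, ENNReal.ofReal_ofNat, Real.abs_exp, mul_comm]
    _ = (2 : NNReal) • volume (s ∩ Ioi 0) := by
        rw [← h_image, setLIntegral_const, ENNReal.smul_def, smul_eq_mul, ENNReal.coe_ofNat]

theorem measurePreserving_abs :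
    MeasurePreserving (fun x : ℝ => |x|) volume
      ((2 : NNReal) • volume.restrict (Ioi (0 : ℝ))) := by
  refine ⟨by fun_prop, Measure.ext fun s hs => ?_⟩
  have h_pos : MeasurableSet (s ∩ Ioi 0) := hs.inter measurableSet_Ioi
  have h_preimage : (fun x : ℝ => |x|) ⁻¹' s =ᵐ[volume]
      (s ∩ Ioi 0 ∪ (fun x => -x) ⁻¹' (s ∩ Ioi 0) : Set ℝ) := by
    filter_upwards [Measure.ae_ne volume (0 : ℝ)] with x hx
    refine propext ?_
    change |x| ∈ s ↔ (x ∈ s ∧ 0 < x) ∨ (-x ∈ s ∧ 0 < -x)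
    rcases lt_or_gt_of_ne hx with h | h
    · simp [abs_of_neg h, h, h.le]
    · simp [abs_of_pos h, h, h.le]
  have h_disj : Disjoint (s ∩ Ioi 0) ((fun x => -x) ⁻¹' (s ∩ Ioi 0)) :=
    Set.disjoint_left.2 fun x hx hx' => lt_asymm hx.2 (neg_pos.1 (mem_Ioi.1 hx'.2))
  rw [Measure.map_apply (by fun_prop) hs, measure_congr h_preimage,
    measure_union h_disj (measurable_neg h_pos), Measure.measure_preimage_neg,
    Measure.smul_apply, Measure.restrict_apply hs, two_smul]

section LogCoordinates

variable {ι : Type*} [Fintype ι]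

theorem lintegral_eq_lintegral_exp {f : (ι → ℝ) → ℝ≥0∞} (hf : Measurable f)
    (hf_abs : ∀ x, f |x| = f x) :
    ∫⁻ x, f x = ∫⁻ s, f (fun i => Real.exp (s i)) ∂(Measure.pi fun _ : ι => expMeasure) := by
  have h_abs := measurePreserving_pi (fun _ : ι => volume) _ fun _ => measurePreserving_abs
  have h_exp := measurePreserving_pi (fun _ : ι => expMeasure) _
    fun _ => measurePreserving_exp_expMeasure
  calc ∫⁻ x, f x = ∫⁻ x, f |x| := by simp only [hf_abs]
    _ = _ := h_abs.lintegral_comp hf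
    _ = _ := (h_exp.lintegral_comp hf).symm

theorem lintegral_rpow_mul_lintegral_rpow_le_of_geomMean {a b : ℝ} (ha : 0 < a) (hb : 0 < b)
    (hab : a + b = 1) {f g h : (ι → ℝ) → ℝ≥0∞} (hf : Measurable f) (hg : Measurable g)
    (hh : Measurable h) (hf_abs : ∀ x, f |x| = f x) (hg_abs : ∀ x, g |x| = g x)
    (hh_abs : ∀ x, h |x| = h x)
    (H : ∀ x y, (∀ i, 0 < x i) → (∀ i, 0 < y i) →
      f x ^ a * g y ^ b ≤ h fun i => x i ^ a * y i ^ b) :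
    (∫⁻ x, f x) ^ a * (∫⁻ x, g x) ^ b ≤ ∫⁻ x, h x := by
  have h_exp : Measurable fun s : ι → ℝ => fun i => Real.exp (s i) := by fun_prop
  rw [lintegral_eq_lintegral_exp hf hf_abs, lintegral_eq_lintegral_exp hg hg_abs,
    lintegral_eq_lintegral_exp hh hh_abs]
  refine IsPrekopaLeindler.pi (fun _ => isPrekopaLeindler_expMeasure ha hb hab) _ _ _
    (hf.comp h_exp) (hg.comp h_exp) (hh.comp h_exp) fun s t => ?_
  convert H _ _ (fun i => Real.exp_pos (s i)) (fun i => Real.exp_pos (t i)) using 3 with i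
  simp only [Pi.add_apply, Pi.smul_apply, smul_eq_mul, Real.exp_add, ← Real.exp_mul, mul_comm]

theorem lintegral_mul_lintegral_rpow_le_of_abs_invariant {p : ℝ} (hp : 1 < p)
    {v : (ι → ℝ) → ℝ} (hv : Measurable v) (hv_abs : ∀ x, v |x| = v x)
    {D : (ι → ℝ) → ι → ℝ} (hD : Measurable D)
    (hvD : ∀ x y, (∀ i, 0 < x i) → (∀ i, 0 < y i) →
      v (fun i => x i ^ (1 / p) * y i ^ (1 - 1 / p)) ≤ (x ⬝ᵥ D y) / p)
    {F G : (ι → ℝ) → ℝ≥0∞} (hF : Measurable F) (hG : Measurable G)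
    (hF_abs : ∀ x, F |x| = F x) (hG_abs : ∀ y, G (D |y|) = G (D y))
    (hFG : ∀ x z, F x * G z ≤ ENNReal.ofReal (Real.exp (-(x ⬝ᵥ z)))) :
    (∫⁻ x, F x) * (∫⁻ y, G (D y) ^ (1 / (p - 1))) ^ (p - 1) ≤
      (∫⁻ x, ENNReal.ofReal (Real.exp (-v x))) ^ p := by
  have hp0 : 0 < p := by linarith
  have hp1 : 0 < p - 1 := by linarith
  have ha : 0 < 1 / p := by positivity
  have hb : 0 < 1 - 1 / p := by rwa [sub_pos, div_lt_one hp0]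
  have h_pl := lintegral_rpow_mul_lintegral_rpow_le_of_geomMean ha hb (by ring) hF
    ((hG.comp hD).pow_const (1 / (p - 1)))
    (h := fun x => ENNReal.ofReal (Real.exp (-v x))) (by fun_prop) hF_abs
    (fun y => by rw [Function.comp_apply, Function.comp_apply, hG_abs])
    (fun x => by rw [hv_abs]) fun x y hx hy => by
      calc F x ^ (1 / p) * (G (D y) ^ (1 / (p - 1))) ^ (1 - 1 / p)
          = (F x * G (D y)) ^ (1 / p) := by
            rw [← ENNReal.rpow_mul, show 1 / (p - 1) * (1 - 1 / p) = 1 / p by field_simp,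
              ENNReal.mul_rpow_of_nonneg _ _ ha.le]
        _ ≤ ENNReal.ofReal (Real.exp (-(x ⬝ᵥ D y))) ^ (1 / p) :=
            ENNReal.rpow_le_rpow (hFG x (D y)) ha.le
        _ = ENNReal.ofReal (Real.exp (-((x ⬝ᵥ D y) / p))) := by
            rw [ENNReal.ofReal_rpow_of_pos (Real.exp_pos _), ← Real.exp_mul]
            ring_nf
        _ ≤ _ := ENNReal.ofReal_le_ofReal (Real.exp_le_exp.2 (neg_le_neg (hvD x y hx hy)))
  have h_pow := ENNReal.rpow_le_rpow h_pl hp0.le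
  rwa [ENNReal.mul_rpow_of_nonneg _ _ hp0.le, ← ENNReal.rpow_mul, ← ENNReal.rpow_mul,
    one_div_mul_cancel hp0.ne', ENNReal.rpow_one,
    show (1 - 1 / p) * p = p - 1 by field_simp] at h_pow

end LogCoordinates

/-! ### Multiplicative polarity and Steiner symmetrization -/

section Polar

variable {ι : Type*} [Fintype ι]

/-- The multiplicative polar `x ↦ inf_z e^{-⟨x, z⟩} / G z`. For `G = e^{-Φ}` it is `e^{-Φ*}`;
points `z` with
`G z = 0` do not contribute to the infimum, as the quotient is `∞` there. -/
noncomputable def polarFun (G : (ι → ℝ) → ℝ≥0∞) (x : ι → ℝ) : ℝ≥0∞ :=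
  ⨅ z, ENNReal.ofReal (Real.exp (-(x ⬝ᵥ z))) / G z

variable {G : (ι → ℝ) → ℝ≥0∞}

theorem le_polarFun_iff {x : ι → ℝ} {c : ℝ≥0∞} :
    c ≤ polarFun G x ↔ ∀ z, c * G z ≤ ENNReal.ofReal (Real.exp (-(x ⬝ᵥ z))) := by
  rw [polarFun, le_iInf_iff]
  exact forall_congr' fun z => ENNReal.le_div_iff_mul_le
    (Or.inr (ENNReal.ofReal_pos.2 (Real.exp_pos _)).ne') (Or.inr ENNReal.ofReal_ne_top)

theorem polarFun_mul_le (G : (ι → ℝ) → ℝ≥0∞) (x z : ι → ℝ) :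
    polarFun G x * G z ≤ ENNReal.ofReal (Real.exp (-(x ⬝ᵥ z))) :=
  le_polarFun_iff.1 le_rfl z

theorem le_polarFun_polarFun (G : (ι → ℝ) → ℝ≥0∞) (x : ι → ℝ) :
    G x ≤ polarFun (polarFun G) x :=
  le_polarFun_iff.2 fun z => by
    rw [mul_comm, dotProduct_comm]
    exact polarFun_mul_le G z x

theorem measurable_polarFun (G : (ι → ℝ) → ℝ≥0∞) : Measurable (polarFun G) := by
  refine UpperSemicontinuous.measurable (upperSemicontinuous_iInf fun z =>
    Continuous.upperSemicontinuous ?_)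
  by_cases h : G z = 0
  · simp only [h, ENNReal.div_zero (ENNReal.ofReal_pos.2 (Real.exp_pos _)).ne',
      continuous_const]
  · have h_exp : Continuous fun x : ι → ℝ => ENNReal.ofReal (Real.exp (-(x ⬝ᵥ z))) := by
      unfold dotProduct
      exact ENNReal.continuous_ofReal.comp (by fun_prop)
    exact (ENNReal.continuous_mul_const (ENNReal.inv_ne_top.2 h)).comp h_exp

theorem polarFun_mul_of_mul_self_eq_one {ε : ι → ℝ} (hε : ε * ε = 1)
    (hG : ∀ z, G (ε * z) = G z) (x : ι → ℝ) : polarFun G (ε * x) = polarFun G x := by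
  have h_le (x : ι → ℝ) : polarFun G (ε * x) ≤ polarFun G x := by
    refine le_polarFun_iff.2 fun z => ?_
    have h_dot : (ε * x) ⬝ᵥ (ε * z) = x ⬝ᵥ z := Finset.sum_congr rfl fun i _ => by
      have : ε i * ε i = 1 := congrFun hε i
      simp only [Pi.mul_apply]
      linear_combination (x i * z i) * this
    simpa only [hG, h_dot] using polarFun_mul_le G (ε * x) (ε * z)
  refine le_antisymm (h_le x) ?_
  simpa only [← mul_assoc, hε, one_mul] using h_le (ε * x)

end Polar

section SignFlip

variable {ι : Type*} [DecidableEq ι]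

/-- The vector of signs such that multiplication by it flips the `i`-th coordinate. -/
def signFlip (i : ι) : ι → ℝ := Function.update 1 i (-1)

theorem signFlip_mul (i : ι) (z : ι → ℝ) : signFlip i * z = Function.update z i (-z i) := by
  ext j
  rcases eq_or_ne j i with rfl | hj
  · simp [signFlip]
  · simp [signFlip, hj]

theorem signFlip_mul_self (i : ι) : signFlip i * signFlip i = 1 := by
  rw [signFlip_mul, signFlip, Function.update_idem, Function.update_self, neg_neg,
    ← Pi.one_apply (M := fun _ : ι => ℝ) i, Function.update_eq_self]

theorem apply_abs_eq_of_signFlip_mul [Finite ι] {β : Type*} {G : (ι → ℝ) → β}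
    (h : ∀ i z, G (signFlip i * z) = G z) (z : ι → ℝ) : G |z| = G z := by
  have := Fintype.ofFinite ι
  suffices ∀ s : Finset ι, G (s.piecewise |z| z) = G z by simpa using this Finset.univ
  intro s
  induction s using Finset.induction_on with
  | empty => simp
  | insert i s hi ih =>
    rw [Finset.piecewise_insert, Pi.abs_apply, ← ih]
    have hzi : s.piecewise |z| z i = z i := Finset.piecewise_eq_of_notMem _ _ _ hi
    rcases abs_choice (z i) with hz | hz
    · rw [hz, ← hzi, Function.update_eq_self]
    · rw [hz, ← h i (s.piecewise |z| z), signFlip_mul, hzi]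

theorem dotProduct_update [Fintype ι] (x z : ι → ℝ) (i : ι) (s : ℝ) :
    x ⬝ᵥ Function.update z i s = x ⬝ᵥ z + x i * (s - z i) := by
  have : Function.update z i s = z + Pi.single i (s - z i) := by
    ext j
    rcases eq_or_ne j i with rfl | hj
    · simp
    · simp [hj]
  rw [this, dotProduct_add, dotProduct_single]

end SignFlip

theorem rpow_half_mul_self (x : ℝ≥0∞) : x ^ (1 / 2 : ℝ) * x ^ (1 / 2 : ℝ) = x := by
  rw [← ENNReal.rpow_add_of_nonneg _ _ (by norm_num) (by norm_num)]
  norm_num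

theorem isPrekopaLeindler_half_volume_real :
    IsPrekopaLeindler (1 / 2) (1 / 2) (volume : Measure ℝ) :=
  isPrekopaLeindler_volume_real (by norm_num) (by norm_num) (by norm_num)

section Steiner

variable {ι : Type*} [DecidableEq ι] {G : (ι → ℝ) → ℝ≥0∞}

/-- Functional Steiner symmetrization in the `i`-th coordinate: in that coordinate, the
supremum over `s - t = 2 z i` of the geometric mean of the values of `G` at `s` and `t`. -/
noncomputable def steinerFun (i : ι) (G : (ι → ℝ) → ℝ≥0∞) (z : ι → ℝ) : ℝ≥0∞ :=
  ⨆ t : ℝ, (G (Function.update z i (t + z i)) * G (Function.update z i (t - z i))) ^ (1 / 2 : ℝ)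

theorem rpow_mul_rpow_le_steinerFun (i : ι) (G : (ι → ℝ) → ℝ≥0∞) (z : ι → ℝ) (s t : ℝ) :
    G (Function.update z i s) ^ (1 / 2 : ℝ) * G (Function.update z i (-t)) ^ (1 / 2 : ℝ) ≤
      steinerFun i G (Function.update z i ((s + t) / 2)) := by
  rw [← ENNReal.mul_rpow_of_nonneg _ _ (by norm_num)]
  refine le_iSup_of_le ((s - t) / 2) (le_of_eq ?_)
  rw [Function.update_idem, Function.update_idem, Function.update_self]
  ring_nf

theorem steinerFun_signFlip_mul (i : ι) (G : (ι → ℝ) → ℝ≥0∞) (z : ι → ℝ) :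
    steinerFun i G (signFlip i * z) = steinerFun i G z := by
  rw [signFlip_mul]
  refine iSup_congr fun t => ?_
  rw [Function.update_idem, Function.update_idem, Function.update_self, mul_comm,
    sub_neg_eq_add, ← sub_eq_add_neg]

theorem steinerFun_mul_of_mul_self_eq_one (i : ι) {ε : ι → ℝ} (hε : ε * ε = 1)
    (hG : ∀ z, G (ε * z) = G z) (z : ι → ℝ) : steinerFun i G (ε * z) = steinerFun i G z := by
  have h_update (z : ι → ℝ) (s : ℝ) :
      G (Function.update (ε * z) i (ε i * s)) = G (Function.update z i s) := by
    rw [← hG (Function.update z i s), Function.update_mul, Function.update_eq_self]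
  have h_le (z : ι → ℝ) : steinerFun i G z ≤ steinerFun i G (ε * z) := by
    refine iSup_le fun t => le_iSup_of_le (ε i * t) (le_of_eq ?_)
    rw [Pi.mul_apply, ← mul_add, ← mul_sub, h_update, h_update]
  refine le_antisymm ?_ (h_le z)
  simpa only [← mul_assoc, hε, one_mul] using h_le (ε * z)

variable [Fintype ι]

theorem polarFun_rpow_mul_le_polarFun_steinerFun (i : ι) (G : (ι → ℝ) → ℝ≥0∞) {x y : ι → ℝ}
    (hxy : x i = y i) :
    polarFun G x ^ (1 / 2 : ℝ) * polarFun G (signFlip i * y) ^ (1 / 2 : ℝ) ≤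
      polarFun (steinerFun i G) ((1 / 2 : ℝ) • x + (1 / 2 : ℝ) • y) := by
  have h_half : (0 : ℝ) ≤ 1 / 2 := by norm_num
  refine le_polarFun_iff.2 fun z => ?_
  rw [steinerFun, ENNReal.mul_iSup]
  refine iSup_le fun t => ?_
  have h_dot : x ⬝ᵥ Function.update z i (t + z i) +
      (signFlip i * y) ⬝ᵥ Function.update z i (t - z i) = x ⬝ᵥ z + y ⬝ᵥ z := by
    rw [signFlip_mul, dotProduct_update, dotProduct_update,
      dotProduct_comm (Function.update y i _) z, dotProduct_update, Function.update_self,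
      dotProduct_comm z y, hxy]
    ring
  rw [← ENNReal.mul_rpow_of_nonneg _ _ h_half, ← ENNReal.mul_rpow_of_nonneg _ _ h_half,
    mul_mul_mul_comm]
  refine (ENNReal.rpow_le_rpow (mul_le_mul' (polarFun_mul_le G _ _) (polarFun_mul_le G _ _))
    h_half).trans (le_of_eq ?_)
  rw [← ENNReal.ofReal_mul (Real.exp_pos _).le, ← Real.exp_add, ← neg_add, h_dot,
    ENNReal.ofReal_rpow_of_pos (Real.exp_pos _), ← Real.exp_mul, add_dotProduct,
    smul_dotProduct, smul_dotProduct, smul_eq_mul, smul_eq_mul]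
  ring_nf

theorem lmarginal_signFlip_mul (i : ι) {F : (ι → ℝ) → ℝ≥0∞} (hF : Measurable F)
    (hF_even : ∀ x, F (-x) = F x) :
    (∫⋯∫⁻_{i}ᶜ, fun x => F (signFlip i * x)) = (∫⋯∫⁻_{i}ᶜ, F) := by
  ext x
  have h_neg (u : ({i}ᶜ : Finset ι) → ℝ) :
      signFlip i * Function.updateFinset x {i}ᶜ u = -Function.updateFinset x {i}ᶜ (-u) := by
    ext j
    rcases eq_or_ne j i with rfl | hj
    · simp [signFlip, Function.updateFinset]
    · simp [signFlip, Function.updateFinset, hj]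
  simp only [lmarginal, h_neg, hF_even]
  exact (Measure.measurePreserving_neg volume).lintegral_comp
    (hF.comp measurable_updateFinset)

theorem lintegral_polarFun_le_lintegral_polarFun_steinerFun (i : ι)
    (hG : ∀ z, G (-z) = G z) : ∫⁻ x, polarFun G x ≤ ∫⁻ x, polarFun (steinerFun i G) x := by
  have h_even (x : ι → ℝ) : polarFun G (-x) = polarFun G x := by
    simpa using polarFun_mul_of_mul_self_eq_one (ε := -1) (by simp) (by simpa using hG) x
  refine lintegral_le_of_lmarginal_le {i}ᶜ (measurable_polarFun G) (measurable_polarFun _)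
    fun x => ?_
  have h_pl := IsPrekopaLeindler.lmarginal (fun _ => isPrekopaLeindler_half_volume_real)
    (measurable_polarFun G) ((measurable_polarFun G).comp (measurable_const_mul (signFlip i)))
    (measurable_polarFun (steinerFun i G)) {i}ᶜ x x fun x' y' hx hy =>
      polarFun_rpow_mul_le_polarFun_steinerFun i G ((hx i (by simp)).trans (hy i (by simp)).symm)
  have h_flip := congrFun (lmarginal_signFlip_mul i (measurable_polarFun G) h_even) x
  rwa [← add_smul, add_halves, one_smul, Function.comp_def, h_flip, rpow_half_mul_self] at h_pl

end Steiner

section Weighted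

theorem setLIntegral_le_setLIntegral_of_rpow_half {k K : ℝ → ℝ≥0∞} (hk : Measurable k)
    (hK : Measurable K) (hkK : ∀ s t, k s ^ (1 / 2 : ℝ) * k (-t) ^ (1 / 2 : ℝ) ≤ K ((s + t) / 2))
    {L : Set ℝ} (hL : MeasurableSet L) (hL_abs : ∀ s ∈ L, ∀ t, t ≠ 0 → |t| ≤ |s| → t ∈ L) :
    ∫⁻ s in L, k s ≤ ∫⁻ s in L, K s := by
  have h_midpoint {s t : ℝ} (hs : s ∈ L) (ht : -t ∈ L) : (s + t) / 2 ∈ insert 0 L := by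
    refine or_iff_not_imp_left.2 fun h0 => ?_
    have h_abs : |(s + t) / 2| ≤ max |s| |(-t)| := by
      rw [abs_neg, abs_div, abs_two]
      linarith [abs_add_le s t, le_max_left |s| |t|, le_max_right |s| |t|]
    rcases le_max_iff.1 h_abs with h | h
    · exact hL_abs s hs _ h0 h
    · exact hL_abs (-t) ht _ h0 h
  have hkL : Measurable (L.indicator k) := hk.indicator hL
  have h_neg : ∫⁻ s, L.indicator k (-s) = ∫⁻ s, L.indicator k s :=
    (Measure.measurePreserving_neg volume).lintegral_comp hkL
  have h_pl := isPrekopaLeindler_half_volume_real _ _ _ hkL (hkL.comp measurable_neg)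
    (hK.indicator (hL.insert 0)) fun s t => by
      by_cases hs : s ∈ L
      · by_cases ht : -t ∈ L
        · have h_smul : (1 / 2 : ℝ) • s + (1 / 2 : ℝ) • t = (s + t) / 2 := by
            simp only [smul_eq_mul]
            ring
          rw [h_smul, Function.comp_apply, indicator_of_mem hs, indicator_of_mem ht,
            indicator_of_mem (h_midpoint hs ht)]
          exact hkK s t
        · simp [indicator_of_notMem ht]
      · simp [indicator_of_notMem hs]
  rwa [Function.comp_def, h_neg, rpow_half_mul_self, lintegral_indicator hL,
    lintegral_indicator (hL.insert 0), setLIntegral_congr (insert_ae_eq_self 0 L)] at h_pl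

theorem lintegral_mul_le_lintegral_mul_of_rpow_half {k K ω : ℝ → ℝ≥0∞} (hk : Measurable k)
    (hK : Measurable K) (hkK : ∀ s t, k s ^ (1 / 2 : ℝ) * k (-t) ^ (1 / 2 : ℝ) ≤ K ((s + t) / 2))
    (hω : Measurable ω) (hω_abs : ∀ s t, t ≠ 0 → |t| ≤ |s| → ω s ≤ ω t) :
    ∫⁻ s, k s * ω s ≤ ∫⁻ s, K s * ω s := by
  rw [lintegral_mul_eq_lintegral_setLIntegral_ofReal_lt hk hω,
    lintegral_mul_eq_lintegral_setLIntegral_ofReal_lt hK hω]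
  exact lintegral_mono fun l => setLIntegral_le_setLIntegral_of_rpow_half hk hK hkK
    (measurableSet_lt measurable_const hω) fun s hs t ht hst => hs.trans_le (hω_abs s t ht hst)

variable {ι : Type*} [DecidableEq ι]

/-- The function `ω` increases when a coordinate is moved towards `0`. Moving a coordinate onto
`0` is excluded, because the density of the gradient image of Lebesgue measure is only
controlled off the coordinate hyperplanes. -/
def IsCoordDecreasing (ω : (ι → ℝ) → ℝ≥0∞) : Prop :=
  ∀ z i t, t ≠ 0 → |t| ≤ |z i| → ω z ≤ ω (Function.update z i t)

variable [Fintype ι] {ω : (ι → ℝ) → ℝ≥0∞} {c : ℝ}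

theorem lintegral_rpow_mul_le_of_steinerFun_le (i : ι) (hc : 0 ≤ c) {G G' : (ι → ℝ) → ℝ≥0∞}
    (hG : Measurable G) (hG' : Measurable G') (hGG' : ∀ z, steinerFun i G z ≤ G' z)
    (hω : Measurable ω) (hω_decr : IsCoordDecreasing ω) :
    ∫⁻ z, G z ^ c * ω z ≤ ∫⁻ z, G' z ^ c * ω z := by
  refine lintegral_le_of_lmarginal_le {i} (by fun_prop) (by fun_prop) fun z => ?_
  simp only [lmarginal_singleton]
  have h_update : Measurable (Function.update z i) := measurable_update z
  refine lintegral_mul_le_lintegral_mul_of_rpow_half (k := fun s => G (Function.update z i s) ^ c)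
    (K := fun s => G' (Function.update z i s) ^ c) (by fun_prop) (by fun_prop) (fun s t => ?_)
    (hω.comp h_update) fun s t ht hst => ?_
  · have h := ENNReal.rpow_le_rpow
      ((rpow_mul_rpow_le_steinerFun i G z s t).trans (hGG' _)) hc
    rwa [ENNReal.mul_rpow_of_nonneg _ _ hc, ← ENNReal.rpow_mul, ← ENNReal.rpow_mul,
      mul_comm (1 / 2) c, ENNReal.rpow_mul, ENNReal.rpow_mul] at h
  · simpa using hω_decr (Function.update z i s) i t ht (by simpa using hst)

/-- Steiner symmetrization followed by double polarity. The supremum in `steinerFun` may destroy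
measurability; the double polar restores it, dominates it and has the same polar. -/
noncomputable def steinerSymm (i : ι) (G : (ι → ℝ) → ℝ≥0∞) : (ι → ℝ) → ℝ≥0∞ :=
  polarFun (polarFun (steinerFun i G))

theorem steinerSymm_mul_of_mul_self_eq_one (i : ι) {G : (ι → ℝ) → ℝ≥0∞} {ε : ι → ℝ}
    (hε : ε * ε = 1) (hG : ∀ z, G (ε * z) = G z) (z : ι → ℝ) :
    steinerSymm i G (ε * z) = steinerSymm i G z :=
  polarFun_mul_of_mul_self_eq_one hε
    (polarFun_mul_of_mul_self_eq_one hε (steinerFun_mul_of_mul_self_eq_one i hε hG)) z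

theorem steinerSymm_signFlip_mul (i : ι) (G : (ι → ℝ) → ℝ≥0∞) (z : ι → ℝ) :
    steinerSymm i G (signFlip i * z) = steinerSymm i G z :=
  polarFun_mul_of_mul_self_eq_one (signFlip_mul_self i)
    (polarFun_mul_of_mul_self_eq_one (signFlip_mul_self i) (steinerFun_signFlip_mul i G)) z

theorem exists_signFlip_invariant (hc : 0 ≤ c) (hω : Measurable ω) (hω_decr : IsCoordDecreasing ω)
    {G : (ι → ℝ) → ℝ≥0∞} (hG : Measurable G) (hG_even : ∀ z, G (-z) = G z) (s : Finset ι) :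
    ∃ G' : (ι → ℝ) → ℝ≥0∞, Measurable G' ∧ (∀ z, G' (-z) = G' z) ∧
      (∀ i ∈ s, ∀ z, G' (signFlip i * z) = G' z) ∧
      ∫⁻ x, polarFun G x ≤ ∫⁻ x, polarFun G' x ∧
      ∫⁻ z, G z ^ c * ω z ≤ ∫⁻ z, G' z ^ c * ω z := by
  induction s using Finset.induction_on with
  | empty => exact ⟨G, hG, hG_even, by simp, le_rfl, le_rfl⟩
  | insert i s _ ih =>
    obtain ⟨G', hG', hG'_even, hG'_flip, h_polar, h_weighted⟩ := ih
    refine ⟨steinerSymm i G', measurable_polarFun _, ?_, ?_, ?_, ?_⟩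
    · simpa using
        steinerSymm_mul_of_mul_self_eq_one i (ε := -1) (by simp) (by simpa using hG'_even)
    · exact Finset.forall_mem_insert .. |>.2 ⟨steinerSymm_signFlip_mul i G', fun j hj =>
        steinerSymm_mul_of_mul_self_eq_one i (signFlip_mul_self j) (hG'_flip j hj)⟩
    · exact (h_polar.trans (lintegral_polarFun_le_lintegral_polarFun_steinerFun i hG'_even)).trans
        (lintegral_mono fun x => le_polarFun_polarFun _ x)
    · exact h_weighted.trans (lintegral_rpow_mul_le_of_steinerFun_le i hc hG'
        (measurable_polarFun _) (fun z => le_polarFun_polarFun _ z) hω hω_decr)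

theorem lintegral_polarFun_mul_lintegral_rpow_le_of_even {p : ℝ} (hp : 1 < p)
    {v : (ι → ℝ) → ℝ} (hv : Measurable v) (hv_abs : ∀ x, v |x| = v x)
    {D : (ι → ℝ) → ι → ℝ} (hD : Measurable D) (hD_abs : ∀ y, |D (|y|)| = |D y|)
    (hvD : ∀ x y, (∀ i, 0 < x i) → (∀ i, 0 < y i) →
      v (fun i => x i ^ (1 / p) * y i ^ (1 - 1 / p)) ≤ (x ⬝ᵥ D y) / p)
    (hω : Measurable ω) (hω_decr : IsCoordDecreasing ω)
    (hωD : ∀ g : (ι → ℝ) → ℝ≥0∞, Measurable g → ∫⁻ y, g (D y) = ∫⁻ z, g z * ω z)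
    {G : (ι → ℝ) → ℝ≥0∞} (hG : Measurable G) (hG_even : ∀ z, G (-z) = G z) :
    (∫⁻ x, polarFun G x) * (∫⁻ y, G (D y) ^ (1 / (p - 1))) ^ (p - 1) ≤
      (∫⁻ x, ENNReal.ofReal (Real.exp (-v x))) ^ p := by
  have : 0 < p - 1 := sub_pos.2 hp
  obtain ⟨G', hG', -, hG'_flip, h_polar, h_weighted⟩ := exists_signFlip_invariant
    (c := 1 / (p - 1)) (by positivity) hω hω_decr hG hG_even Finset.univ
  have hG'_abs : ∀ z, G' |z| = G' z :=
    apply_abs_eq_of_signFlip_mul fun i => hG'_flip i (Finset.mem_univ i)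
  have h_polar_abs : ∀ x, polarFun G' |x| = polarFun G' x :=
    apply_abs_eq_of_signFlip_mul fun i =>
      polarFun_mul_of_mul_self_eq_one (signFlip_mul_self i) (hG'_flip i (Finset.mem_univ i))
  calc (∫⁻ x, polarFun G x) * (∫⁻ y, G (D y) ^ (1 / (p - 1))) ^ (p - 1)
      = (∫⁻ x, polarFun G x) * (∫⁻ z, G z ^ (1 / (p - 1)) * ω z) ^ (p - 1) := by
        rw [hωD (fun z => G z ^ (1 / (p - 1))) (by fun_prop)]
    _ ≤ (∫⁻ x, polarFun G' x) * (∫⁻ z, G' z ^ (1 / (p - 1)) * ω z) ^ (p - 1) := by gcongr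
    _ = (∫⁻ x, polarFun G' x) * (∫⁻ y, G' (D y) ^ (1 / (p - 1))) ^ (p - 1) := by
        rw [hωD (fun z => G' z ^ (1 / (p - 1))) (by fun_prop)]
    _ ≤ _ := lintegral_mul_lintegral_rpow_le_of_abs_invariant hp hv hv_abs hD hvD
        (measurable_polarFun G') hG' h_polar_abs
        (fun y => by rw [← hG'_abs, hD_abs, hG'_abs]) (polarFun_mul_le G')

end Weighted

/-! ### Gradients of convex functions -/

section Gradient

variable {E F : Type*} [NormedAddCommGroup E] [NormedSpace ℝ E] [NormedAddCommGroup F]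
  [NormedSpace ℝ F]

theorem hasDerivAt_comp_add_smul {f : E → F} {x : E} (hf : DifferentiableAt ℝ f x) (v : E) :
    HasDerivAt (fun t : ℝ => f (x + t • v)) (fderiv ℝ f x v) 0 := by
  have h_line : HasDerivAt (fun t : ℝ => x + t • v) v 0 := by
    simpa using ((hasDerivAt_id (0 : ℝ)).smul_const v).const_add x
  exact HasFDerivAt.comp_hasDerivAt 0 (by simpa using hf.hasFDerivAt) h_line

theorem fderiv_sub_le_of_convexOn {f : E → ℝ} (hf : ConvexOn ℝ univ f) {x : E}
    (hd : DifferentiableAt ℝ f x) (y : E) : fderiv ℝ f x (y - x) ≤ f y - f x := by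
  have h_line := hf.comp_affineMap (AffineMap.lineMap x y)
  have h_deriv : HasDerivAt (f ∘ AffineMap.lineMap x y) (fderiv ℝ f x (y - x)) (0 : ℝ) := by
    refine (hasDerivAt_comp_add_smul hd (y - x)).congr_of_eventuallyEq (.of_forall fun t => ?_)
    simp only [Function.comp_apply, AffineMap.lineMap_apply_module', add_comm]
  simpa [slope_def_field] using
    h_line.le_slope_of_hasDerivAt (mem_univ 0) (mem_univ 1) zero_lt_one h_deriv

theorem fderiv_sub_lt_of_strictConvexOn {f : E → ℝ} (hf : StrictConvexOn ℝ univ f) {x y : E}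
    (hd : DifferentiableAt ℝ f x) (hxy : x ≠ y) : fderiv ℝ f x (y - x) < f y - f x := by
  have h_tangent := fderiv_sub_le_of_convexOn hf.convexOn hd ((1 / 2 : ℝ) • x + (1 / 2 : ℝ) • y)
  have h_midpoint := hf.2 (mem_univ x) (mem_univ y) hxy one_half_pos one_half_pos (add_halves 1)
  have h_sub : (1 / 2 : ℝ) • x + (1 / 2 : ℝ) • y - x = (1 / 2 : ℝ) • (y - x) := by module
  rw [h_sub, map_smul] at h_tangent
  simp only [smul_eq_mul] at h_tangent h_midpoint
  linarith

end Gradient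

section InnerGradient

variable {E : Type*} [NormedAddCommGroup E] [InnerProductSpace ℝ E] [CompleteSpace E] {f : E → ℝ}

theorem gradient_map_of_comp_eq (R : E ≃ₗᵢ[ℝ] E) (h : ∀ x, f (R x) = f x) (x : E) :
    ∇ f (R x) = R (∇ f x) := by
  refine ext_inner_right ℝ fun v => ?_
  have h_chain : fderiv ℝ f x (R.symm v) = fderiv ℝ f (R x) v := by
    conv_lhs => rw [← show f ∘ R.toContinuousLinearEquiv = f from funext h]
    rw [R.toContinuousLinearEquiv.comp_right_fderiv]
    simp
  rw [inner_gradient_left, ← h_chain, ← inner_gradient_left, ← R.inner_map_map,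
    R.apply_symm_apply]

theorem continuous_gradient (hf : ContDiff ℝ 1 f) : Continuous (∇ f) :=
  (InnerProductSpace.toDual ℝ E).symm.continuous.comp (hf.continuous_fderiv one_ne_zero)

theorem gradient_injective (hf : StrictConvexOn ℝ univ f) (hd : Differentiable ℝ f) :
    Function.Injective (∇ f) := by
  intro x y hxy
  by_contra hne
  have h_xy := fderiv_sub_lt_of_strictConvexOn hf (hd x) hne
  have h_yx := fderiv_sub_lt_of_strictConvexOn hf (hd y) (Ne.symm hne)
  rw [← inner_gradient_left] at h_xy h_yx
  rw [← hxy, ← neg_sub y x, inner_neg_right] at h_yx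
  linarith

theorem inner_gradient_sub_nonneg (hf : ConvexOn ℝ univ f) (hd : Differentiable ℝ f) (x y : E) :
    0 ≤ inner ℝ (∇ f y - ∇ f x) (y - x) := by
  have h_xy := fderiv_sub_le_of_convexOn hf (hd x) y
  have h_yx := fderiv_sub_le_of_convexOn hf (hd y) x
  rw [← inner_gradient_left] at h_xy h_yx
  rw [← neg_sub y x, inner_neg_right] at h_yx
  rw [inner_sub_left]
  linarith

theorem hasGradientAt_of_continuousAt_subgradient {g : E → ℝ} {T : E → E} {z : E}
    (hgT : ∀ w u, inner ℝ (T w) (u - w) ≤ g u - g w) (hT : ContinuousAt T z) :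
    HasGradientAt g (T z) z := by
  rw [hasGradientAt_iff_isLittleO]
  have h_small : (fun w => ‖T w - T z‖ * ‖w - z‖) =o[nhds z] fun w => w - z := by
    have h_one : (fun w => ‖T w - T z‖) =o[nhds z] fun _ => (1 : ℝ) :=
      (Asymptotics.isLittleO_one_iff ℝ).2 (tendsto_iff_norm_sub_tendsto_zero.1 hT)
    simpa using h_one.mul_isBigO (Asymptotics.isBigO_norm_left.2
      (Asymptotics.isBigO_refl (fun w => w - z) (nhds z))).norm_right
  refine (Asymptotics.isBigO_of_le _ fun w => ?_).trans_isLittleO h_small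
  have h_zw := hgT z w
  have h_wz := hgT w z
  have h_cauchy := real_inner_le_norm (T w - T z) (w - z)
  rw [inner_sub_left] at h_cauchy
  rw [← neg_sub w z, inner_neg_right] at h_wz
  have h_nonneg : 0 ≤ ‖T w - T z‖ * ‖w - z‖ := by positivity
  rw [Real.norm_of_nonneg (by linarith), Real.norm_of_nonneg h_nonneg]
  linarith

open Filter Topology Bornology

theorem tendsto_gradient_cobounded (hf : ConvexOn ℝ univ f) (hd : Differentiable ℝ f)
    (hf_lim : Tendsto (fun x => f x / ‖x‖) (cobounded E) atTop) :
    Tendsto (∇ f) (cobounded E) (cobounded E) := by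
  rw [← tendsto_norm_atTop_iff_cobounded]
  have h_const : Tendsto (fun x : E => -f 0 / ‖x‖) (cobounded E) (𝓝 0) :=
    tendsto_norm_cobounded_atTop.const_div_atTop _
  refine tendsto_atTop_mono' _ ?_ (hf_lim.atTop_add h_const)
  filter_upwards [tendsto_norm_cobounded_atTop.eventually_gt_atTop 0] with x hx
  have h_tangent := fderiv_sub_le_of_convexOn hf (hd x) 0
  rw [← inner_gradient_left, zero_sub, inner_neg_right] at h_tangent
  have h_cauchy := real_inner_le_norm (∇ f x) x
  rw [← add_div, div_le_iff₀ hx]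
  linarith

theorem gradient_surjective [FiniteDimensional ℝ E] (hd : Differentiable ℝ f)
    (hf_lim : Tendsto (fun x => f x / ‖x‖) (cobounded E) atTop) : Function.Surjective (∇ f) := by
  intro y
  have h_lim : Tendsto (fun x => f x - inner ℝ y x) (cocompact E) atTop := by
    rw [← Metric.cobounded_eq_cocompact]
    refine tendsto_atTop_mono' _ ?_ (tendsto_norm_cobounded_atTop.atTop_mul_atTop₀
      (tendsto_atTop_add_const_right _ (-‖y‖) hf_lim))
    filter_upwards [tendsto_norm_cobounded_atTop.eventually_gt_atTop 0] with x hx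
    have h_cauchy := real_inner_le_norm y x
    rw [mul_add, mul_div_cancel₀ _ hx.ne']
    linarith
  have h_cont : Continuous fun x => f x - inner ℝ y x := hd.continuous.sub (by fun_prop)
  obtain ⟨x, hx⟩ := h_cont.exists_forall_le h_lim
  refine ⟨x, ext_inner_right ℝ fun v => ?_⟩
  have h_crit : fderiv ℝ f x - innerSL ℝ y = 0 := by
    rw [← ((hd x).hasFDerivAt.sub (innerSL ℝ y).hasFDerivAt).fderiv]
    exact IsLocalMin.fderiv_eq_zero (Eventually.of_forall hx)
  rw [inner_gradient_left, sub_eq_zero.1 h_crit, innerSL_apply_apply]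

/-- The gradient of a strictly convex `C¹` function of superlinear growth, as a homeomorphism. -/
noncomputable def gradientHomeomorph [FiniteDimensional ℝ E] (hf : StrictConvexOn ℝ univ f)
    (hC : ContDiff ℝ 1 f) (hf_lim : Tendsto (fun x => f x / ‖x‖) (cobounded E) atTop) : E ≃ₜ E :=
  have hd := hC.differentiable one_ne_zero
  (Equiv.ofBijective (∇ f) ⟨gradient_injective hf hd,
    gradient_surjective hd hf_lim⟩).toHomeomorphOfContinuousClosed (continuous_gradient hC) <| by
      refine (isProperMap_iff_tendsto_cocompact.2 ⟨continuous_gradient hC, ?_⟩).isClosedMap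
      simpa only [Metric.cobounded_eq_cocompact] using
        tendsto_gradient_cobounded hf.convexOn hd hf_lim

end InnerGradient

section Homogeneous

variable {E : Type*} [NormedAddCommGroup E] [NormedSpace ℝ E] {p : ℝ} {V : E → ℝ}

theorem fderiv_self_of_homogeneous (hV : ∀ c : ℝ, 0 < c → ∀ x, V (c • x) = c ^ p * V x) {x : E}
    (hd : DifferentiableAt ℝ V x) : fderiv ℝ V x x = p * V x := by
  have h_rpow : HasDerivAt (fun t : ℝ => (1 + t) ^ p * V x) (p * V x) 0 := by
    simpa using (((hasDerivAt_id (0 : ℝ)).const_add 1).rpow_const (p := p)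
      (Or.inl (by norm_num))).mul_const (V x)
  refine (hasDerivAt_comp_add_smul hd x).unique (h_rpow.congr_of_eventuallyEq ?_)
  filter_upwards [Ioi_mem_nhds (show (-1 : ℝ) < 0 by norm_num)] with t ht
  rw [mem_Ioi] at ht
  rw [← hV (1 + t) (by linarith), add_smul, one_smul]

theorem apply_zero_of_homogeneous (hp : 0 < p)
    (hV : ∀ c : ℝ, 0 < c → ∀ x, V (c • x) = c ^ p * V x) : V 0 = 0 := by
  have h := hV 2 two_pos 0
  rw [smul_zero] at h
  have h_rpow : (1 : ℝ) < 2 ^ p := Real.one_lt_rpow one_lt_two hp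
  exact (mul_eq_zero.1 (show ((2 : ℝ) ^ p - 1) * V 0 = 0 by linarith)).resolve_left
    (sub_ne_zero.2 h_rpow.ne')

theorem pos_of_homogeneous (hp : 1 < p) (hconv : StrictConvexOn ℝ univ V)
    (hV : ∀ c : ℝ, 0 < c → ∀ x, V (c • x) = c ^ p * V x) {x : E} (hx : x ≠ 0) : 0 < V x := by
  have h_half := hconv.2 (mem_univ x) (mem_univ 0) hx one_half_pos one_half_pos (add_halves 1)
  rw [smul_zero, add_zero, apply_zero_of_homogeneous (by linarith) hV, smul_zero, add_zero,
    hV _ one_half_pos, smul_eq_mul] at h_half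
  have h_rpow : (1 / 2 : ℝ) ^ p < 1 / 2 := by
    simpa using Real.rpow_lt_rpow_of_exponent_gt one_half_pos one_half_lt_one hp
  exact pos_of_mul_pos_right (by linarith : 0 < (1 / 2 - (1 / 2 : ℝ) ^ p) * V x) (by linarith)

theorem exists_mul_norm_rpow_le [FiniteDimensional ℝ E] (hp : 1 < p)
    (hconv : StrictConvexOn ℝ univ V)
    (hV : ∀ c : ℝ, 0 < c → ∀ x, V (c • x) = c ^ p * V x) :
    ∃ m > 0, ∀ x, m * ‖x‖ ^ p ≤ V x := by
  have h_zero : V 0 = 0 := apply_zero_of_homogeneous (by linarith) hV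
  have h_at_zero (m : ℝ) : m * ‖(0 : E)‖ ^ p ≤ V 0 := by
    rw [h_zero, norm_zero, Real.zero_rpow (by linarith), mul_zero]
  rcases subsingleton_or_nontrivial E with _ | _
  · exact ⟨1, one_pos, fun x => Subsingleton.elim 0 x ▸ h_at_zero 1⟩
  have h_cont : Continuous V := by
    rw [← continuousOn_univ]
    exact hconv.convexOn.continuousOn isOpen_univ
  obtain ⟨u, hu, h_min⟩ := (isCompact_sphere (0 : E) 1).exists_isMinOn
    (NormedSpace.sphere_nonempty.2 zero_le_one) h_cont.continuousOn
  refine ⟨V u, pos_of_homogeneous hp hconv hV (ne_zero_of_mem_unit_sphere ⟨u, hu⟩), fun x => ?_⟩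
  rcases eq_or_ne x 0 with rfl | hx
  · exact h_at_zero _
  have h_norm : 0 < ‖x‖ := norm_pos_iff.2 hx
  calc V u * ‖x‖ ^ p ≤ V (‖x‖⁻¹ • x) * ‖x‖ ^ p := by
        gcongr
        exact h_min (by simp [norm_smul, hx])
    _ = V x := by rw [mul_comm, ← hV _ h_norm, smul_inv_smul₀ h_norm.ne']

open Filter Bornology in
theorem tendsto_div_norm_of_homogeneous [FiniteDimensional ℝ E] (hp : 1 < p)
    (hconv : StrictConvexOn ℝ univ V)
    (hV : ∀ c : ℝ, 0 < c → ∀ x, V (c • x) = c ^ p * V x) :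
    Tendsto (fun x => V x / ‖x‖) (cobounded E) atTop := by
  obtain ⟨m, hm, hmV⟩ := exists_mul_norm_rpow_le hp hconv hV
  refine tendsto_atTop_mono' _ ?_ (((tendsto_rpow_atTop (sub_pos.2 hp)).const_mul_atTop hm).comp
    tendsto_norm_cobounded_atTop)
  filter_upwards [tendsto_norm_cobounded_atTop.eventually_gt_atTop 0] with x hx
  rw [le_div_iff₀ hx, Function.comp_apply, mul_assoc, ← Real.rpow_add_one hx.ne', sub_add_cancel]
  exact hmV x

end Homogeneous

section Legendre

variable {n : ℕ} {f : EuclideanSpace ℝ (Fin n) → ℝ}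

theorem legendreReal_gradient (hconv : ConvexOn ℝ univ f) {x : EuclideanSpace ℝ (Fin n)}
    (hd : DifferentiableAt ℝ f x) : legendreReal f (∇ f x) = inner ℝ x (∇ f x) - f x := by
  suffices legendre (fun x => (f x : EReal)) (∇ f x) = ((inner ℝ x (∇ f x) - f x : ℝ) : EReal) by
    rw [legendreReal, this, EReal.toReal_coe]
  refine le_antisymm (iSup_le fun y => ?_) ?_
  · rw [← EReal.coe_sub, EReal.coe_le_coe_iff]
    have h_tangent := fderiv_sub_le_of_convexOn hconv hd y
    rw [← inner_gradient_left, inner_sub_right, real_inner_comm, real_inner_comm x] at h_tangent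
    linarith
  · rw [EReal.coe_sub]
    exact le_iSup (fun y => ((inner ℝ y (∇ f x) : ℝ) : EReal) - (f y : EReal)) x

theorem hasGradientAt_legendreReal (hconv : ConvexOn ℝ univ f) (hd : Differentiable ℝ f)
    {T : EuclideanSpace ℝ (Fin n) → EuclideanSpace ℝ (Fin n)} (hfT : ∀ z, ∇ f (T z) = z)
    {z : EuclideanSpace ℝ (Fin n)} (hT : ContinuousAt T z) :
    HasGradientAt (legendreReal f) (T z) z := by
  have h_eq (w) : legendreReal f w = inner ℝ (T w) w - f (T w) := by
    simpa only [hfT] using legendreReal_gradient hconv (hd (T w))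
  refine hasGradientAt_of_continuousAt_subgradient (fun w u => ?_) hT
  have h_tangent := fderiv_sub_le_of_convexOn hconv (hd (T u)) (T w)
  rw [← inner_gradient_left, hfT, inner_sub_right, real_inner_comm, real_inner_comm (T u)]
    at h_tangent
  rw [h_eq, h_eq, inner_sub_right]
  linarith

end Legendre

section Determinant

theorem det_nonneg_of_inner_nonneg {E : Type*} [NormedAddCommGroup E] [InnerProductSpace ℝ E]
    [FiniteDimensional ℝ E] (A : E →L[ℝ] E) (hA : ∀ v, 0 ≤ inner ℝ (A v) v) : 0 ≤ A.det := by
  by_contra! h_neg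
  let B : ℝ → E →L[ℝ] E := fun s => s • A + (1 - s) • ContinuousLinearMap.id ℝ E
  have hB : Continuous fun s => (B s).det :=
    ContinuousLinearMap.continuous_det.comp (by fun_prop)
  have hB_zero : (B 0).det = 1 := by simp [B, ContinuousLinearMap.det]
  have hB_one : (B 1).det = A.det := by simp [B]
  obtain ⟨s, ⟨hs0, hs_le⟩, h_det⟩ := intermediate_value_Icc' zero_le_one hB.continuousOn
    (show (0 : ℝ) ∈ Icc (B 1).det (B 0).det by
      rw [hB_zero, hB_one]
      exact ⟨h_neg.le, zero_le_one⟩)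
  have hs1 : s < 1 := lt_of_le_of_ne hs_le fun hs => by
    subst hs
    exact h_neg.ne (hB_one.symm.trans h_det)
  obtain ⟨v, hv, hv0⟩ := (Submodule.ne_bot_iff _).1
    (LinearMap.bot_lt_ker_of_det_eq_zero (f := (B s : E →ₗ[ℝ] E)) h_det).ne'
  have h_inner : s * inner ℝ (A v) v + (1 - s) * ‖v‖ ^ 2 = 0 := by
    calc s * inner ℝ (A v) v + (1 - s) * ‖v‖ ^ 2 = inner ℝ (B s v) v := by
          simp [B, inner_add_left, inner_smul_left]
      _ = 0 := by rw [show B s v = 0 from hv, inner_zero_left]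
  have hv_pos : 0 < ‖v‖ ^ 2 := by positivity
  nlinarith [mul_nonneg hs0 (hA v), mul_pos (sub_pos.2 hs1) hv_pos]

theorem det_fderiv_nonneg_of_inner_sub_nonneg {E : Type*} [NormedAddCommGroup E]
    [InnerProductSpace ℝ E] [FiniteDimensional ℝ E] {T : E → E}
    (hT : ∀ x y, 0 ≤ inner ℝ (T y - T x) (y - x)) {x : E} (hd : DifferentiableAt ℝ T x) :
    0 ≤ (fderiv ℝ T x).det := by
  refine det_nonneg_of_inner_nonneg _ fun v => ?_
  refine ge_of_tendsto ((hasDerivAt_comp_add_smul hd v).tendsto_slope_zero_right.inner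
    (tendsto_const_nhds (x := v))) ?_
  filter_upwards [self_mem_nhdsWithin] with t (ht : 0 < t)
  have h_mono := hT x (x + t • v)
  rw [add_sub_cancel_left, inner_smul_right] at h_mono
  rw [zero_add, zero_smul, add_zero, real_inner_smul_left]
  exact mul_nonneg (inv_nonneg.2 ht.le) (nonneg_of_mul_nonneg_right h_mono ht)

theorem det_fderiv_map_of_comm {𝕜 E : Type*} [NontriviallyNormedField 𝕜] [NormedAddCommGroup E]
    [NormedSpace 𝕜 E] {T : E → E} (R : E ≃L[𝕜] E) (h : ∀ x, T (R x) = R (T x)) (x : E) :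
    (fderiv 𝕜 T (R x)).det = (fderiv 𝕜 T x).det := by
  have h_comp : (fderiv 𝕜 T (R x)).comp (R : E →L[𝕜] E) =
      (R : E →L[𝕜] E).comp (fderiv 𝕜 T x) := by
    rw [← R.comp_right_fderiv, show T ∘ R = R ∘ T from funext h, R.comp_fderiv]
  have h_conj : fderiv 𝕜 T (R x) =
      ((R : E →L[𝕜] E).comp (fderiv 𝕜 T x)).comp (R.symm : E →L[𝕜] E) := by
    rw [← h_comp]
    ext v
    simp
  rw [h_conj]
  exact LinearMap.det_conj (fderiv 𝕜 T x : E →ₗ[𝕜] E) R.toLinearEquiv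

end Determinant

section CoordReflection

variable {ι : Type*} [Fintype ι] [DecidableEq ι]

/-- The reflection of `ℝⁿ` in the hyperplane `x i = 0`; on coordinates it is multiplication by
`signFlip i`. -/
noncomputable def coordReflection (i : ι) : EuclideanSpace ℝ ι ≃ₗᵢ[ℝ] EuclideanSpace ℝ ι :=
  LinearIsometryEquiv.piLpCongrRight 2 fun j =>
    if j = i then LinearIsometryEquiv.neg ℝ else LinearIsometryEquiv.refl ℝ ℝ

theorem ofLp_coordReflection (i : ι) (x : EuclideanSpace ℝ ι) :
    WithLp.ofLp (coordReflection i x) = signFlip i * WithLp.ofLp x := by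
  ext j
  rcases eq_or_ne j i with rfl | hj
  · simp [coordReflection, signFlip]
  · simp [coordReflection, signFlip, hj]

theorem toLp_signFlip_mul (i : ι) (x : ι → ℝ) :
    WithLp.toLp 2 (signFlip i * x) = coordReflection i (WithLp.toLp 2 x) :=
  WithLp.ofLp_injective 2 (ofLp_coordReflection i _).symm

theorem coordReflection_eq_self_iff {i : ι} {x : EuclideanSpace ℝ ι} :
    coordReflection i x = x ↔ x i = 0 := by
  rw [← (WithLp.ofLp_injective 2).eq_iff, ofLp_coordReflection, signFlip_mul,
    Function.update_eq_self_iff, neg_eq_self]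

theorem IsUnconditional.comp_coordReflection {n : ℕ} {β : Type*}
    {f : EuclideanSpace ℝ (Fin n) → β} (hf : IsUnconditional f) (i : Fin n)
    (x : EuclideanSpace ℝ (Fin n)) : f (coordReflection i x) = f x := by
  refine hf _ _ fun j => ?_
  rw [ofLp_coordReflection, signFlip_mul]
  rcases eq_or_ne j i with rfl | hj
  · simp
  · simp [hj]

end CoordReflection

section Tangent

variable {n : ℕ} {p : ℝ} {V : EuclideanSpace ℝ (Fin n) → ℝ}

theorem hasDerivAt_rpow_mul_rpow_line (p : ℝ) (x : ℝ) {y : ℝ} (hy : 0 < y) :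
    HasDerivAt (fun t : ℝ => (y + t * (x - y)) ^ (1 / p) * y ^ (1 - 1 / p)) ((x - y) / p) 0 := by
  have h_line : HasDerivAt (fun t : ℝ => y + t * (x - y)) (x - y) 0 := by
    simpa using ((hasDerivAt_id (0 : ℝ)).mul_const (x - y)).const_add y
  refine ((h_line.rpow_const (p := 1 / p) (Or.inl (by simpa using hy.ne'))).mul_const
    _).congr_deriv ?_
  rw [zero_mul, add_zero, mul_assoc, ← Real.rpow_add hy]
  simp [div_eq_mul_inv]

theorem concaveOn_rpow_mul_rpow (hp : 0 < p)
    (hV_conc : ConcaveOn ℝ {x : EuclideanSpace ℝ (Fin n) | ∀ i, 0 ≤ x i}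
      (fun x => V (WithLp.toLp 2 (fun i => x i ^ (1 / p)))))
    {y : Fin n → ℝ} (hy : ∀ i, 0 < y i) :
    ConcaveOn ℝ {x : Fin n → ℝ | ∀ i, 0 ≤ x i}
      (fun x => V (WithLp.toLp 2 fun i => x i ^ (1 / p) * y i ^ (1 - 1 / p))) := by
  let scale : (Fin n → ℝ) →ₗ[ℝ] EuclideanSpace ℝ (Fin n) :=
    (WithLp.linearEquiv 2 ℝ (Fin n → ℝ)).symm.toLinearMap ∘ₗ
      LinearMap.mulRight ℝ fun i => y i ^ (p - 1)
  have h_scale (x : Fin n → ℝ) (i : Fin n) : scale x i = x i * y i ^ (p - 1) := rfl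
  have h_nonneg {x : Fin n → ℝ} (hx : ∀ i, 0 ≤ x i) (i : Fin n) : 0 ≤ scale x i :=
    mul_nonneg (hx i) (Real.rpow_nonneg (hy i).le _)
  have h_convex : Convex ℝ {x : Fin n → ℝ | ∀ i, 0 ≤ x i} := convex_Ici 0
  refine ((hV_conc.comp_linearMap scale).subset (fun x hx => h_nonneg hx) h_convex).congr ?_
  intro x hx
  rw [Function.comp_apply]
  congr 2
  ext i
  rw [h_scale, Real.mul_rpow (hx i) (Real.rpow_nonneg (hy i).le _), ← Real.rpow_mul (hy i).le]
  congr 2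
  field_simp

theorem hasDerivAt_apply_rpow_mul_rpow_line {x y : Fin n → ℝ} (hy : ∀ i, 0 < y i)
    (hd : DifferentiableAt ℝ V (WithLp.toLp 2 y)) :
    HasDerivAt (fun t : ℝ => V (WithLp.toLp 2 fun i =>
        (y i + t * (x i - y i)) ^ (1 / p) * y i ^ (1 - 1 / p)))
      (fderiv ℝ V (WithLp.toLp 2 y) (p⁻¹ • (WithLp.toLp 2 x - WithLp.toLp 2 y))) 0 := by
  have h_curve : HasDerivAt
      (fun t : ℝ => WithLp.toLp 2 fun i => (y i + t * (x i - y i)) ^ (1 / p) * y i ^ (1 - 1 / p))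
      (WithLp.toLp 2 fun i => (x i - y i) / p) 0 :=
    (PiLp.continuousLinearEquiv 2 ℝ fun _ : Fin n => ℝ).symm.hasFDerivAt.comp_hasDerivAt 0
      (hasDerivAt_pi.2 fun i => hasDerivAt_rpow_mul_rpow_line p (x i) (hy i))
  have h_deriv : p⁻¹ • (WithLp.toLp 2 x - WithLp.toLp 2 y) =
      WithLp.toLp 2 fun i => (x i - y i) / p := by
    ext i
    simp [div_eq_inv_mul]
  rw [h_deriv]
  refine HasFDerivAt.comp_hasDerivAt 0 ?_ h_curve
  simpa only [zero_mul, add_zero, ← Real.rpow_add (hy _), add_sub_cancel, Real.rpow_one] using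
    hd.hasFDerivAt

theorem apply_rpow_mul_rpow_le (hp : 0 < p)
    (hV_hom : ∀ c : ℝ, 0 < c → ∀ x, V (c • x) = c ^ p * V x)
    (hV_conc : ConcaveOn ℝ {x : EuclideanSpace ℝ (Fin n) | ∀ i, 0 ≤ x i}
      (fun x => V (WithLp.toLp 2 (fun i => x i ^ (1 / p)))))
    {x y : Fin n → ℝ} (hx : ∀ i, 0 ≤ x i) (hy : ∀ i, 0 < y i)
    (hd : DifferentiableAt ℝ V (WithLp.toLp 2 y)) :
    V (WithLp.toLp 2 fun i => x i ^ (1 / p) * y i ^ (1 - 1 / p)) ≤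
      (x ⬝ᵥ WithLp.ofLp (∇ V (WithLp.toLp 2 y))) / p := by
  let W : (Fin n → ℝ) → ℝ := fun x => V (WithLp.toLp 2 fun i => x i ^ (1 / p) * y i ^ (1 - 1 / p))
  have hW_self : W y = V (WithLp.toLp 2 y) := by
    simp only [W, ← Real.rpow_add (hy _), add_sub_cancel, Real.rpow_one]
  have hW_deriv : HasDerivAt (W ∘ AffineMap.lineMap y x)
      (fderiv ℝ V (WithLp.toLp 2 y) (p⁻¹ • (WithLp.toLp 2 x - WithLp.toLp 2 y))) (0 : ℝ) := by
    refine (hasDerivAt_apply_rpow_mul_rpow_line (p := p) (x := x) hy hd).congr_of_eventuallyEq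
      (.of_forall fun t => ?_)
    simp [W, AffineMap.lineMap_apply, add_comm]
  have hW_conc : ConcaveOn ℝ {x | ∀ i, 0 ≤ x i} W := concaveOn_rpow_mul_rpow hp hV_conc hy
  have h_tangent := (hW_conc.comp_affineMap (AffineMap.lineMap y x)).slope_le_of_hasDerivAt
    (x := (0 : ℝ)) (y := 1) (by simpa using fun i => (hy i).le) (by simpa using hx) zero_lt_one
    hW_deriv
  have h_inner : fderiv ℝ V (WithLp.toLp 2 y) (WithLp.toLp 2 x) =
      x ⬝ᵥ WithLp.ofLp (∇ V (WithLp.toLp 2 y)) := by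
    rw [← inner_gradient_left, EuclideanSpace.inner_eq_star_dotProduct, star_trivial]
  rw [slope_def_field, sub_zero, div_one, Function.comp_apply, AffineMap.lineMap_apply_one,
    Function.comp_apply, AffineMap.lineMap_apply_zero, hW_self, map_smul, map_sub, h_inner,
    fderiv_self_of_homogeneous hV_hom hd, smul_eq_mul, mul_sub, inv_mul_cancel_left₀ hp.ne',
    sub_le_sub_iff_right, ← div_eq_inv_mul] at h_tangent
  exact h_tangent

end Tangent

/-! ### The density of the gradient image of Lebesgue measure -/

section Monotone

variable {ι : Type*} [Finite ι] {δ : (ι → ℝ) → ℝ} {A : Set (ι → ℝ)}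

theorem isOpen_forall_pos : IsOpen {z : ι → ℝ | ∀ i, 0 < z i} := by
  simp only [ofPred_forall]
  exact isOpen_iInter_of_finite fun i => isOpen_lt continuous_const (continuous_apply i)

theorem apply_le_apply_add_single_of_dense [DecidableEq ι] (hA_open : IsOpen A)
    (hA_dense : Dense A)
    (hδ : ContinuousOn δ {z | ∀ i, 0 < z i})
    (hδ_le : ∀ z ∈ A, (∀ j, 0 < z j) → ∀ i t, 0 ≤ t → z + Pi.single i t ∈ A →
      δ z ≤ δ (z + Pi.single i t))
    {z : ι → ℝ} (hz : ∀ j, 0 < z j) (i : ι) {t : ℝ} (ht : 0 ≤ t) :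
    δ z ≤ δ (z + Pi.single i t) := by
  let P : Set (ι → ℝ) := {z | ∀ i, 0 < z i}
  have hP_open : IsOpen P := isOpen_forall_pos
  have h_nonneg : (0 : ι → ℝ) ≤ Pi.single i t := Pi.single_nonneg.2 ht
  have hP_add {w : ι → ℝ} (hw : w ∈ P) : w + Pi.single i t ∈ P := fun j =>
    (hw j).trans_le (le_add_of_nonneg_right (h_nonneg j))
  have h_shift : Continuous fun w : ι → ℝ => w + Pi.single i t := by fun_prop
  have h_dense : Dense (A ∩ (· + Pi.single i t) ⁻¹' A) :=
    hA_dense.inter_of_isOpen_left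
      (hA_dense.preimage (Homeomorph.addRight (Pi.single i t : ι → ℝ)).isOpenMap) hA_open
  have h_mem : z ∈ closure (P ∩ (A ∩ (· + Pi.single i t) ⁻¹' A)) :=
    h_dense.open_subset_closure_inter hP_open hz
  refine ContinuousWithinAt.closure_le h_mem
    (hδ.continuousAt (hP_open.mem_nhds hz)).continuousWithinAt
    (ContinuousAt.comp (f := (· + Pi.single i t))
      (hδ.continuousAt (hP_open.mem_nhds (hP_add hz))) h_shift.continuousAt).continuousWithinAt ?_
  exact fun w hw => hδ_le w hw.2.1 hw.1 i t ht hw.2.2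

theorem monotoneOn_forall_pos_of_dense [DecidableEq ι] (hA_open : IsOpen A)
    (hA_dense : Dense A)
    (hδ : ContinuousOn δ {z | ∀ i, 0 < z i})
    (hδ_le : ∀ z ∈ A, (∀ j, 0 < z j) → ∀ i t, 0 ≤ t → z + Pi.single i t ∈ A →
      δ z ≤ δ (z + Pi.single i t)) :
    MonotoneOn δ {z | ∀ i, 0 < z i} := by
  intro u hu z _ huz
  have := Fintype.ofFinite ι
  have h_chain (S : Finset ι) : δ u ≤ δ (u + ∑ i ∈ S, Pi.single i (z i - u i)) := by
    induction S using Finset.induction with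
    | empty => simp
    | insert i S hi ih =>
      have h_nonneg : 0 ≤ ∑ i ∈ S, (Pi.single i (z i - u i) : ι → ℝ) :=
        Finset.sum_nonneg fun i _ => Pi.single_nonneg.2 (sub_nonneg.2 (huz i))
      have h_pos (j : ι) : 0 < (u + ∑ i ∈ S, Pi.single i (z i - u i)) j :=
        (hu j).trans_le (le_add_of_nonneg_right (h_nonneg j))
      rw [Finset.sum_insert hi, add_comm (Pi.single _ _), ← add_assoc]
      exact ih.trans (apply_le_apply_add_single_of_dense hA_open hA_dense hδ hδ_le h_pos i
        (sub_nonneg.2 (huz i)))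
  have h_sum : u + ∑ i, Pi.single i (z i - u i) = z := by
    rw [Finset.univ_sum_single fun i => z i - u i]
    exact add_sub_cancel u z
  simpa only [h_sum] using h_chain Finset.univ

theorem pos_of_monotoneOn_of_dense (hA_dense : Dense A)
    (hδ_pos : ∀ z ∈ A, 0 < δ z) (hδ_mono : MonotoneOn δ {z | ∀ i, 0 < z i}) {z : ι → ℝ}
    (hz : ∀ i, 0 < z i) : 0 < δ z := by
  have h_box : (interior (Icc 0 z)).Nonempty := by
    rw [← pi_univ_Icc, interior_pi_set finite_univ]
    exact ⟨fun i => z i / 2, fun i _ => by simpa using hz i⟩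
  obtain ⟨u, hu, huA⟩ := hA_dense.inter_open_nonempty _ isOpen_interior h_box
  rw [← pi_univ_Icc, interior_pi_set finite_univ] at hu
  simp only [interior_Icc] at hu
  exact (hδ_pos u huA).trans_le
    (hδ_mono (fun i => (hu i trivial).1) hz fun i => (hu i trivial).2.le)

end Monotone

section InverseDerivative

variable {𝕜 E : Type*} [NontriviallyNormedField 𝕜] [CompleteSpace 𝕜] [NormedAddCommGroup E]
  [NormedSpace 𝕜 E] [FiniteDimensional 𝕜 E] {e : E ≃ₜ E} {z : E}

theorem hasFDerivAt_symm_of_det_ne_zero (hd : DifferentiableAt 𝕜 e (e.symm z))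
    (hdet : (fderiv 𝕜 e (e.symm z)).det ≠ 0) :
    HasFDerivAt e.symm
      (((fderiv 𝕜 e (e.symm z)).toContinuousLinearEquivOfDetNeZero hdet).symm : E →L[𝕜] E) z := by
  refine HasFDerivAt.of_local_left_inverse e.symm.continuous.continuousAt ?_
    (Filter.Eventually.of_forall e.apply_symm_apply)
  rw [ContinuousLinearMap.coe_toContinuousLinearEquivOfDetNeZero]
  exact hd.hasFDerivAt

theorem det_fderiv_symm (hd : DifferentiableAt 𝕜 e (e.symm z))
    (hdet : (fderiv 𝕜 e (e.symm z)).det ≠ 0) :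
    (fderiv 𝕜 e.symm z).det = ((fderiv 𝕜 e (e.symm z)).det)⁻¹ := by
  rw [(hasFDerivAt_symm_of_det_ne_zero hd hdet).fderiv, ContinuousLinearEquiv.det_coe_symm,
    ContinuousLinearMap.coe_toContinuousLinearEquivOfDetNeZero]

end InverseDerivative

theorem toLp_update_zero_add_smul_single {ι : Type*} [DecidableEq ι] (z : ι → ℝ) (i : ι) (t : ℝ) :
    WithLp.toLp 2 (Function.update z i 0) + t • EuclideanSpace.single i (1 : ℝ) =
      WithLp.toLp 2 (Function.update z i t) := by
  ext j
  rcases eq_or_ne j i with rfl | hj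
  · simp
  · simp [hj]

section CoordinateHyperplanes

variable {ι : Type*} [Fintype ι]

theorem lintegral_euclideanSpace (f : EuclideanSpace ℝ ι → ℝ≥0∞) :
    ∫⁻ x, f x = ∫⁻ x : ι → ℝ, f (WithLp.toLp 2 x) :=
  ((PiLp.volume_preserving_toLp ι).lintegral_comp_emb
    (MeasurableEquiv.toLp 2 (ι → ℝ)).measurableEmbedding f).symm

theorem ae_forall_coord_ne_zero : ∀ᵐ x : EuclideanSpace ℝ ι, ∀ i, x i ≠ 0 :=
  (PiLp.volume_preserving_ofLp ι).quasiMeasurePreserving.ae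
    (ae_all_iff.2 fun i => Measure.ae_eval_ne _ i 0)

theorem isOpen_forall_ne_zero {ι : Type*} [Finite ι] : IsOpen {z : ι → ℝ | ∀ i, z i ≠ 0} := by
  simp only [ofPred_forall]
  exact isOpen_iInter_of_finite fun i => isOpen_ne.preimage (continuous_apply i)

theorem isOpen_forall_coord_ne_zero {ι : Type*} [Finite ι] :
    IsOpen {x : EuclideanSpace ℝ ι | ∀ i, x i ≠ 0} :=
  isOpen_forall_ne_zero.preimage (PiLp.continuous_ofLp 2 _)

end CoordinateHyperplanes

section Density

variable {ι : Type*} [Fintype ι] {e : EuclideanSpace ℝ ι ≃ₜ EuclideanSpace ℝ ι}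

/-- The Jacobian determinant of `e` at the preimage of the point with coordinates `z`. -/
noncomputable def symmJacobian (e : EuclideanSpace ℝ ι ≃ₜ EuclideanSpace ℝ ι) (z : ι → ℝ) : ℝ :=
  (fderiv ℝ e (e.symm (WithLp.toLp 2 z))).det

/-- The density of the image of Lebesgue measure under `e`, for `e` with positive Jacobian off the
coordinate hyperplanes. On the hyperplanes, where `e` need not be differentiable, it is set
to `0`. -/
noncomputable def imageDensity (e : EuclideanSpace ℝ ι ≃ₜ EuclideanSpace ℝ ι) : (ι → ℝ) → ℝ≥0∞ :=
  {z | ∀ i, z i ≠ 0}.indicator fun z => ENNReal.ofReal (symmJacobian e z)⁻¹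

theorem measurable_imageDensity {ι : Type*} [Finite ι]
    {e : EuclideanSpace ℝ ι ≃ₜ EuclideanSpace ℝ ι} : Measurable (imageDensity e) := by
  have := Fintype.ofFinite ι
  have h_symm : Measurable fun z : ι → ℝ => e.symm (WithLp.toLp 2 z) :=
    (e.symm.continuous.comp (PiLp.continuous_toLp 2 _)).measurable
  have h_jac : Measurable (symmJacobian e) :=
    (ContinuousLinearMap.continuous_det.measurable.comp (measurable_fderiv ℝ e)).comp h_symm
  exact h_jac.inv.ennreal_ofReal.indicator isOpen_forall_ne_zero.measurableSet

variable [DecidableEq ι]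
  (he_refl : ∀ i x, e (coordReflection i x) = coordReflection i (e x))
  (he_C1 : ContDiffOn ℝ 1 e {x | ∀ i, x i ≠ 0})

include he_refl

theorem forall_coord_ne_zero_iff (x : EuclideanSpace ℝ ι) :
    (∀ i, e x i ≠ 0) ↔ ∀ i, x i ≠ 0 := by
  refine forall_congr' fun i => not_congr ?_
  rw [← coordReflection_eq_self_iff, ← coordReflection_eq_self_iff, ← he_refl,
    e.injective.eq_iff]

theorem symm_coord_ne_zero {z : ι → ℝ} (hz : ∀ i, z i ≠ 0) (i : ι) :
    e.symm (WithLp.toLp 2 z) i ≠ 0 :=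
  (forall_coord_ne_zero_iff he_refl _).1 (by simpa using hz) i

theorem symmJacobian_signFlip_mul (i : ι) (z : ι → ℝ) :
    symmJacobian e (signFlip i * z) = symmJacobian e z := by
  have h_symm : e.symm (coordReflection i (WithLp.toLp 2 z)) =
      coordReflection i (e.symm (WithLp.toLp 2 z)) := by
    rw [e.symm_apply_eq, he_refl, e.apply_symm_apply]
  rw [symmJacobian, toLp_signFlip_mul, h_symm]
  exact det_fderiv_map_of_comm (coordReflection i).toContinuousLinearEquiv (he_refl i) _

include he_C1

theorem differentiableAt_preimage {z : ι → ℝ} (hz : ∀ i, z i ≠ 0) :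
    DifferentiableAt ℝ e (e.symm (WithLp.toLp 2 z)) :=
  (he_C1.differentiableOn one_ne_zero).differentiableAt
    (isOpen_forall_coord_ne_zero.mem_nhds (symm_coord_ne_zero he_refl hz))

theorem continuousOn_symmJacobian : ContinuousOn (symmJacobian e) {z | ∀ i, z i ≠ 0} := by
  have h_det : ContinuousOn (fun x => (fderiv ℝ e x).det) {x | ∀ i, x i ≠ 0} :=
    ContinuousLinearMap.continuous_det.comp_continuousOn
      (he_C1.continuousOn_fderiv_of_isOpen isOpen_forall_coord_ne_zero le_rfl)
  exact h_det.comp (e.symm.continuous.comp (PiLp.continuous_toLp 2 _)).continuousOn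
    fun z hz => symm_coord_ne_zero he_refl hz

theorem dense_symmJacobian_ne_zero :
    Dense {z : ι → ℝ | (∀ i, z i ≠ 0) ∧ symmJacobian e z ≠ 0} := by
  let critical := {x : EuclideanSpace ℝ ι | (∀ i, x i ≠ 0) ∧ (fderiv ℝ e x).det = 0}
  have h_sard : volume (e '' critical) = 0 :=
    addHaar_image_eq_zero_of_det_fderivWithin_eq_zero volume (f' := fderiv ℝ e)
      (fun x hx => ((he_C1.differentiableOn one_ne_zero).differentiableAt
        (isOpen_forall_coord_ne_zero.mem_nhds hx.1)).hasFDerivAt.hasFDerivWithinAt)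
      fun x hx => hx.2
  have h_ae := (PiLp.volume_preserving_toLp ι).quasiMeasurePreserving.ae
    (ae_forall_coord_ne_zero.and (measure_eq_zero_iff_ae_notMem.1 h_sard))
  refine (Measure.dense_of_ae h_ae).mono fun z hz => ⟨hz.1, fun h_zero => hz.2 ?_⟩
  exact ⟨_, ⟨symm_coord_ne_zero he_refl hz.1, h_zero⟩, e.apply_symm_apply _⟩

theorem isOpen_symmJacobian_ne_zero :
    IsOpen {z : ι → ℝ | (∀ i, z i ≠ 0) ∧ symmJacobian e z ≠ 0} :=
  (continuousOn_symmJacobian he_refl he_C1).isOpen_inter_preimage isOpen_forall_ne_zero isOpen_ne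

variable
  (he_mono : ∀ x y, 0 ≤ inner ℝ (e y - e x) (y - x))
  (he_anti : ∀ i : ι, ∀ x : EuclideanSpace ℝ ι, x i = 0 →
    AntitoneOn (fun t : ℝ => (fderiv ℝ e.symm (x + t • EuclideanSpace.single i 1)).det)
      {t : ℝ | 0 ≤ t ∧ DifferentiableAt ℝ e.symm (x + t • EuclideanSpace.single i 1)})

include he_mono

theorem symmJacobian_pos_of_ne_zero {z : ι → ℝ} (hz : ∀ i, z i ≠ 0)
    (h_ne : symmJacobian e z ≠ 0) : 0 < symmJacobian e z :=
  (det_fderiv_nonneg_of_inner_sub_nonneg he_mono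
    (differentiableAt_preimage he_refl he_C1 hz)).lt_of_ne h_ne.symm

include he_anti

theorem monotoneOn_symmJacobian : MonotoneOn (symmJacobian e) {z | ∀ i, 0 < z i} := by
  refine monotoneOn_forall_pos_of_dense (isOpen_symmJacobian_ne_zero he_refl he_C1)
    (dense_symmJacobian_ne_zero he_refl he_C1)
    ((continuousOn_symmJacobian he_refl he_C1).mono fun z hz i => (hz i).ne') ?_
  intro z hzA hz i t ht hztA
  have h_add : z + Pi.single i t = Function.update z i (z i + t) := by
    ext j
    rcases eq_or_ne j i with rfl | hj
    · simp
    · simp [hj]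
  have h_line (s : ℝ) : WithLp.toLp 2 (Function.update z i 0) + s • EuclideanSpace.single i 1 =
      WithLp.toLp 2 (Function.update z i s) := toLp_update_zero_add_smul_single z i s
  have h_diff {w : ι → ℝ} (hw : (∀ j, w j ≠ 0) ∧ symmJacobian e w ≠ 0) :
      DifferentiableAt ℝ e.symm (WithLp.toLp 2 w) :=
    (hasFDerivAt_symm_of_det_ne_zero (differentiableAt_preimage he_refl he_C1 hw.1)
      hw.2).differentiableAt
  have h_det {w : ι → ℝ} (hw : (∀ j, w j ≠ 0) ∧ symmJacobian e w ≠ 0) :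
      (fderiv ℝ e.symm (WithLp.toLp 2 w)).det = (symmJacobian e w)⁻¹ :=
    det_fderiv_symm (differentiableAt_preimage he_refl he_C1 hw.1) hw.2
  have h_anti := he_anti i (WithLp.toLp 2 (Function.update z i 0)) (by simp)
    (a := z i) ⟨(hz i).le, by simpa only [h_line, Function.update_eq_self] using h_diff hzA⟩
    (b := z i + t) ⟨add_nonneg (hz i).le ht, by simpa only [h_line, ← h_add] using h_diff hztA⟩
    (le_add_of_nonneg_right ht)
  simp only [h_line, ← h_add, Function.update_eq_self, h_det hzA, h_det hztA] at h_anti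
  exact (inv_le_inv₀ (symmJacobian_pos_of_ne_zero he_refl he_C1 he_mono hztA.1 hztA.2)
    (symmJacobian_pos_of_ne_zero he_refl he_C1 he_mono hzA.1 hzA.2)).1 h_anti

theorem symmJacobian_pos {z : ι → ℝ} (hz : ∀ i, z i ≠ 0) : 0 < symmJacobian e z := by
  rw [← apply_abs_eq_of_signFlip_mul (symmJacobian_signFlip_mul he_refl) z]
  exact pos_of_monotoneOn_of_dense (dense_symmJacobian_ne_zero he_refl he_C1)
    (fun z hz => symmJacobian_pos_of_ne_zero he_refl he_C1 he_mono hz.1 hz.2)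
    (monotoneOn_symmJacobian he_refl he_C1 he_mono he_anti) fun i => abs_pos.2 (hz i)

theorem isCoordDecreasing_imageDensity : IsCoordDecreasing (imageDensity e) := by
  intro z i t ht htz
  by_cases hz : ∀ j, z j ≠ 0
  · have h_update (j : ι) : Function.update z i t j ≠ 0 := by
      rcases eq_or_ne j i with rfl | hj
      · simpa using ht
      · simpa [hj] using hz j
    have h_abs_le : |Function.update z i t| ≤ |z| := fun j => by
      rcases eq_or_ne j i with rfl | hj
      · simpa using htz
      · simp [hj]
    have h_jac : symmJacobian e (Function.update z i t) ≤ symmJacobian e z := by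
      rw [← apply_abs_eq_of_signFlip_mul (symmJacobian_signFlip_mul he_refl) z,
        ← apply_abs_eq_of_signFlip_mul (symmJacobian_signFlip_mul he_refl) (Function.update z i t)]
      exact monotoneOn_symmJacobian he_refl he_C1 he_mono he_anti
        (fun j => abs_pos.2 (h_update j)) (fun j => abs_pos.2 (hz j)) h_abs_le
    rw [imageDensity, indicator_of_mem (by exact hz), indicator_of_mem (by exact h_update)]
    exact ENNReal.ofReal_le_ofReal
      (inv_anti₀ (symmJacobian_pos he_refl he_C1 he_mono he_anti h_update) h_jac)
  · rw [imageDensity, indicator_of_notMem (by exact hz)]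
    exact zero_le

theorem lintegral_comp_eq_lintegral_mul_imageDensity (g : (ι → ℝ) → ℝ≥0∞) :
    ∫⁻ y : ι → ℝ, g (WithLp.ofLp (e (WithLp.toLp 2 y))) = ∫⁻ z, g z * imageDensity e z := by
  let U := {x : EuclideanSpace ℝ ι | ∀ i, x i ≠ 0}
  have hU : IsOpen U := isOpen_forall_coord_ne_zero
  have h_restrict : (volume : Measure (EuclideanSpace ℝ ι)).restrict U = volume :=
    Measure.restrict_eq_self_of_ae_mem ae_forall_coord_ne_zero
  have h_image : e '' U = U := by
    rw [e.image_eq_preimage_symm]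
    ext z
    have h := forall_coord_ne_zero_iff he_refl (e.symm z)
    rw [e.apply_symm_apply] at h
    exact h.symm
  have h_change := lintegral_image_eq_lintegral_abs_det_fderiv_mul volume hU.measurableSet
    (fun x hx => ((he_C1.differentiableOn one_ne_zero).differentiableAt
      (hU.mem_nhds hx)).hasFDerivAt.hasFDerivWithinAt) e.injective.injOn
    fun z => g (WithLp.ofLp z) * imageDensity e (WithLp.ofLp z)
  rw [h_image, h_restrict, lintegral_euclideanSpace] at h_change
  rw [← lintegral_euclideanSpace fun y => g (WithLp.ofLp (e y)), h_change, ← h_restrict]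
  refine setLIntegral_congr_fun hU.measurableSet fun x hx => ?_
  have hex : ∀ i, e x i ≠ 0 := (forall_coord_ne_zero_iff he_refl x).2 hx
  have h_pos := symmJacobian_pos he_refl he_C1 he_mono he_anti hex
  have h_jac : symmJacobian e (WithLp.ofLp (e x)) = (fderiv ℝ e x).det := by
    rw [symmJacobian, WithLp.toLp_ofLp, e.symm_apply_apply]
  rw [imageDensity, indicator_of_mem (by exact hex), mul_left_comm,
    ← ENNReal.ofReal_mul (abs_nonneg _)]
  rw [h_jac] at h_pos ⊢
  rw [abs_of_pos h_pos, mul_inv_cancel₀ h_pos.ne', ENNReal.ofReal_one, mul_one]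

end Density

/-! ### The two inequalities -/

section Functional

variable {n : ℕ} {p : ℝ} {V : EuclideanSpace ℝ (Fin n) → ℝ}

theorem exp_neg_mul_exp_neg_legendre_le (Φ : EuclideanSpace ℝ (Fin n) → EReal)
    (x z : EuclideanSpace ℝ (Fin n)) :
    EReal.exp (-Φ x) * EReal.exp (-legendre Φ z) ≤ ENNReal.ofReal (Real.exp (-inner ℝ x z)) := by
  have h_le : ((inner ℝ x z : ℝ) : EReal) - Φ x ≤ legendre Φ z :=
    le_iSup (fun x => ((inner ℝ x z : ℝ) : EReal) - Φ x) x
  induction h : Φ x with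
  | bot =>
    rw [h, EReal.sub_bot (EReal.coe_ne_bot _), top_le_iff] at h_le
    simp [h_le]
  | top => simp
  | coe r =>
    rw [h, ← EReal.coe_sub] at h_le
    calc EReal.exp (-r) * EReal.exp (-legendre Φ z)
      _ ≤ EReal.exp (-r) * EReal.exp (-((inner ℝ x z - r : ℝ) : EReal)) :=
        mul_le_mul_right (EReal.exp_monotone (EReal.neg_le_neg_iff.2 h_le)) _
      _ = ENNReal.ofReal (Real.exp (-inner ℝ x z)) := by
        rw [← EReal.coe_neg, ← EReal.coe_neg, EReal.exp_coe, EReal.exp_coe,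
          ← ENNReal.ofReal_mul (Real.exp_nonneg _), ← Real.exp_add]
        ring_nf

theorem inner_toLp_toLp {ι : Type*} [Fintype ι] (x z : ι → ℝ) :
    inner ℝ (WithLp.toLp 2 x : EuclideanSpace ℝ ι) (WithLp.toLp 2 z) = x ⬝ᵥ z := by
  rw [EuclideanSpace.inner_toLp_toLp, star_trivial, dotProduct_comm]

/-- `e^{-Φ}` as a function of the coordinates. -/
noncomputable def expNegCoord (Φ : EuclideanSpace ℝ (Fin n) → EReal) (x : Fin n → ℝ) : ℝ≥0∞ :=
  EReal.exp (-Φ (WithLp.toLp 2 x))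

/-- The map `∇ V` in coordinates. -/
noncomputable def gradientCoord (V : EuclideanSpace ℝ (Fin n) → ℝ) (y : Fin n → ℝ) : Fin n → ℝ :=
  WithLp.ofLp (∇ V (WithLp.toLp 2 y))

theorem exp_neg_legendre_le_polarFun (Φ : EuclideanSpace ℝ (Fin n) → EReal)
    (z : EuclideanSpace ℝ (Fin n)) :
    EReal.exp (-legendre Φ z) ≤ polarFun (expNegCoord Φ) (WithLp.ofLp z) := by
  refine le_polarFun_iff.2 fun x => ?_
  rw [mul_comm, dotProduct_comm, ← inner_toLp_toLp]
  exact exp_neg_mul_exp_neg_legendre_le Φ _ z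

theorem blaschkeSantalo_le_polarFun (hp : 1 < p) (V : EuclideanSpace ℝ (Fin n) → ℝ)
    (Φ : EuclideanSpace ℝ (Fin n) → EReal) :
    blaschkeSantalo p V Φ ≤ (∫⁻ x, polarFun (polarFun (expNegCoord Φ)) x) *
      (∫⁻ y, polarFun (expNegCoord Φ) (gradientCoord V y) ^ (1 / (p - 1))) ^ (p - 1) := by
  have : 0 < p - 1 := sub_pos.2 hp
  rw [blaschkeSantalo, lintegral_euclideanSpace, lintegral_euclideanSpace]
  gcongr with x y
  · exact le_polarFun_polarFun (expNegCoord Φ) x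
  · rw [mul_comm, ← EReal.neg_mul, EReal.exp_mul]
    exact ENNReal.rpow_le_rpow (exp_neg_legendre_le_polarFun Φ _) (by positivity)

theorem measurable_gradientCoord : Measurable (gradientCoord V) :=
  (PiLp.continuous_ofLp 2 _).measurable.comp <|
    ((InnerProductSpace.toDual ℝ _).symm.continuous.measurable.comp (measurable_fderiv ℝ V)).comp
      (PiLp.continuous_toLp 2 _).measurable

theorem IsUnconditional.abs_gradientCoord_abs (hV : IsUnconditional V) (y : Fin n → ℝ) :
    |gradientCoord V (|y|)| = |gradientCoord V y| := by
  refine apply_abs_eq_of_signFlip_mul (G := fun y => |gradientCoord V y|) (fun i z => ?_) y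
  have h_refl : gradientCoord V (signFlip i * z) = signFlip i * gradientCoord V z := by
    rw [gradientCoord, toLp_signFlip_mul,
      gradient_map_of_comp_eq (coordReflection i) (hV.comp_coordReflection i),
      ofLp_coordReflection, gradientCoord]
  rw [h_refl, signFlip_mul]
  ext j
  rcases eq_or_ne j i with rfl | hj
  · simp
  · simp [hj]

theorem IsUnconditional.expNegCoord_signFlip_mul {Φ : EuclideanSpace ℝ (Fin n) → EReal}
    (hΦ : IsUnconditional Φ) (i : Fin n) (x : Fin n → ℝ) :
    expNegCoord Φ (signFlip i * x) = expNegCoord Φ x := by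
  rw [expNegCoord, toLp_signFlip_mul, hΦ.comp_coordReflection, expNegCoord]

end Functional

section Inequalities

variable {n : ℕ} {p : ℝ} (hp : 1 < p) {V : EuclideanSpace ℝ (Fin n) → ℝ}
  (hV_hom : ∀ c : ℝ, 0 < c → ∀ x, V (c • x) = c ^ p * V x)
  (hV_diff : Differentiable ℝ V) (hV_unc : IsUnconditional V)
  (hV_conc : ConcaveOn ℝ {x : EuclideanSpace ℝ (Fin n) | ∀ i, 0 ≤ x i}
    (fun x => V (WithLp.toLp 2 (fun i => x i ^ (1 / p)))))
  {Φ : EuclideanSpace ℝ (Fin n) → EReal}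

include hp hV_hom hV_diff hV_unc hV_conc

theorem blaschkeSantalo_le_of_isUnconditional (hΦ : IsUnconditional Φ) :
    blaschkeSantalo p V Φ ≤ (∫⁻ x, ENNReal.ofReal (Real.exp (-V x))) ^ p := by
  have h_polar_flip (i : Fin n) := polarFun_mul_of_mul_self_eq_one (signFlip_mul_self i)
    (hΦ.expNegCoord_signFlip_mul i)
  have h_polar_abs := apply_abs_eq_of_signFlip_mul h_polar_flip
  refine (blaschkeSantalo_le_polarFun hp V Φ).trans ?_
  rw [lintegral_euclideanSpace]
  exact lintegral_mul_lintegral_rpow_le_of_abs_invariant hp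
    (v := fun x => V (WithLp.toLp 2 x))
    (hV_diff.continuous.comp (PiLp.continuous_toLp 2 _)).measurable
    (fun x => hV_unc _ _ fun i => by simp) measurable_gradientCoord
    (fun x y hx hy =>
      apply_rpow_mul_rpow_le (by positivity) hV_hom hV_conc (fun i => (hx i).le) hy (hV_diff _))
    (measurable_polarFun _) (measurable_polarFun _)
    (apply_abs_eq_of_signFlip_mul fun i =>
      polarFun_mul_of_mul_self_eq_one (signFlip_mul_self i) (h_polar_flip i))
    (fun y => by
      rw [← h_polar_abs (gradientCoord V |y|), hV_unc.abs_gradientCoord_abs, h_polar_abs])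
    (polarFun_mul_le _)

theorem blaschkeSantalo_le_of_even {ω : (Fin n → ℝ) → ℝ≥0∞} (hω : Measurable ω)
    (hω_decr : IsCoordDecreasing ω)
    (hω_grad : ∀ g : (Fin n → ℝ) → ℝ≥0∞, Measurable g →
      ∫⁻ y, g (gradientCoord V y) = ∫⁻ z, g z * ω z)
    (hΦ : ∀ x, Φ (-x) = Φ x) :
    blaschkeSantalo p V Φ ≤ (∫⁻ x, ENNReal.ofReal (Real.exp (-V x))) ^ p := by
  refine (blaschkeSantalo_le_polarFun hp V Φ).trans ?_
  rw [lintegral_euclideanSpace]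
  refine lintegral_polarFun_mul_lintegral_rpow_le_of_even hp
    (v := fun x => V (WithLp.toLp 2 x))
    (hV_diff.continuous.comp (PiLp.continuous_toLp 2 _)).measurable
    (fun x => hV_unc _ _ fun i => by simp) measurable_gradientCoord hV_unc.abs_gradientCoord_abs
    (fun x y hx hy =>
      apply_rpow_mul_rpow_le (by positivity) hV_hom hV_conc (fun i => (hx i).le) hy (hV_diff _))
    hω hω_decr hω_grad (measurable_polarFun _) fun z => ?_
  rw [← neg_one_mul]
  refine polarFun_mul_of_mul_self_eq_one (by simp) (fun x => ?_) z
  rw [neg_one_mul, expNegCoord, WithLp.toLp_neg, hΦ, expNegCoord]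

omit hV_diff hV_unc hV_conc

theorem exists_isCoordDecreasing_density (hV_convex : StrictConvexOn ℝ univ V)
    (hV_C1 : ContDiff ℝ 1 V) (hV_C2 : ContDiffOn ℝ 2 V {x | ∀ i, x i ≠ 0})
    (hV_unc : IsUnconditional V)
    (hV_anti : ∀ i : Fin n, ∀ x' : EuclideanSpace ℝ (Fin n), x' i = 0 →
      AntitoneOn (fun t : ℝ => hessianDet (legendreReal V) (x' + t • EuclideanSpace.single i 1))
        {t : ℝ | 0 ≤ t ∧
          HasHessianAt (legendreReal V) (x' + t • EuclideanSpace.single i 1)}) :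
    ∃ ω : (Fin n → ℝ) → ℝ≥0∞, Measurable ω ∧ IsCoordDecreasing ω ∧
      ∀ g : (Fin n → ℝ) → ℝ≥0∞, ∫⁻ y, g (gradientCoord V y) = ∫⁻ z, g z * ω z := by
  have hV_diff : Differentiable ℝ V := hV_C1.differentiable one_ne_zero
  let e := gradientHomeomorph hV_convex hV_C1
    (tendsto_div_norm_of_homogeneous hp hV_convex hV_hom)
  have he_refl (i : Fin n) : ∀ x, e (coordReflection i x) = coordReflection i (e x) :=
    gradient_map_of_comp_eq (coordReflection i) (hV_unc.comp_coordReflection i)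
  have he_C1 : ContDiffOn ℝ 1 e {x | ∀ i, x i ≠ 0} :=
    (InnerProductSpace.toDual ℝ (EuclideanSpace ℝ (Fin n))).symm.contDiff.comp_contDiffOn
      (hV_C2.fderiv_of_isOpen isOpen_forall_coord_ne_zero le_rfl)
  have he_mono : ∀ x y, 0 ≤ inner ℝ (e y - e x) (y - x) :=
    inner_gradient_sub_nonneg hV_convex.convexOn hV_diff
  have he_symm : ∇ (legendreReal V) = e.symm := gradient_eq fun z =>
    hasGradientAt_legendreReal hV_convex.convexOn hV_diff e.apply_symm_apply
      e.symm.continuous.continuousAt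
  simp only [hessianDet, HasHessianAt, he_symm] at hV_anti
  exact ⟨imageDensity e, measurable_imageDensity,
    isCoordDecreasing_imageDensity he_refl he_C1 he_mono hV_anti,
    lintegral_comp_eq_lintegral_mul_imageDensity he_refl he_C1 he_mono hV_anti⟩

end Inequalities

theorem theoremA_general {n : ℕ} {p : ℝ} (hp : 1 < p) {V : EuclideanSpace ℝ (Fin n) → ℝ}
    (hV_hom : ∀ c : ℝ, 0 < c → ∀ x, V (c • x) = c ^ p * V x)
    (hV_diff : Differentiable ℝ V) (hV_unc : IsUnconditional V)
    (hV_conc : ConcaveOn ℝ {x : EuclideanSpace ℝ (Fin n) | ∀ i, 0 ≤ x i}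
      (fun x => V (WithLp.toLp 2 (fun i => x i ^ (1 / p))))) :
    (∀ Φ : EuclideanSpace ℝ (Fin n) → EReal, IsUnconditional Φ →
      blaschkeSantalo p V Φ ≤ (∫⁻ x, ENNReal.ofReal (Real.exp (-V x))) ^ p) ∧
    (StrictConvexOn ℝ univ V → ContDiff ℝ 1 V → ContDiffOn ℝ 2 V {x | ∀ i, x i ≠ 0} →
      (∀ i : Fin n, ∀ x' : EuclideanSpace ℝ (Fin n), x' i = 0 →
        AntitoneOn (fun t : ℝ => hessianDet (legendreReal V) (x' + t • EuclideanSpace.single i 1))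
          {t : ℝ | 0 ≤ t ∧
            HasHessianAt (legendreReal V) (x' + t • EuclideanSpace.single i 1)}) →
      ∀ Φ : EuclideanSpace ℝ (Fin n) → EReal, (∀ x, Φ (-x) = Φ x) →
        blaschkeSantalo p V Φ ≤ (∫⁻ x, ENNReal.ofReal (Real.exp (-V x))) ^ p) := by
  refine ⟨fun Φ => blaschkeSantalo_le_of_isUnconditional hp hV_hom hV_diff hV_unc hV_conc, ?_⟩
  intro hV_convex hV_C1 hV_C2 hV_anti Φ hΦ
  obtain ⟨ω, hω, hω_decr, hω_grad⟩ :=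
    exists_isCoordDecreasing_density hp hV_hom hV_convex hV_C1 hV_C2 hV_unc hV_anti
  exact blaschkeSantalo_le_of_even hp hV_hom hV_diff hV_unc hV_conc hω hω_decr
    (fun g _ => hω_grad g) hΦ

theorem theoremA {n : ℕ} (p : ℝ) (hp : 1 < p) (V : EuclideanSpace ℝ (Fin n) → ℝ)
    (hV_even : ∀ x, V (-x) = V x)
    (hV_convex : StrictConvexOn ℝ univ V)
    (hV_hom : ∀ c : ℝ, 0 < c → ∀ x, V (c • x) = c ^ p * V x)
    (hV_C1 : ContDiff ℝ 1 V)
    (hV_C2 : ContDiffOn ℝ 2 V {x | ∀ i, x i ≠ 0})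
    (hV_unc : IsUnconditional V)
    (hV_conc : ConcaveOn ℝ {x : EuclideanSpace ℝ (Fin n) | ∀ i, 0 ≤ x i}
      (fun x => V (WithLp.toLp 2 (fun i => x i ^ (1 / p))))) :
    (∀ Φ : EuclideanSpace ℝ (Fin n) → EReal, IsProperConvex Φ → IsUnconditional Φ →
      blaschkeSantalo p V Φ ≤ (∫⁻ x, ENNReal.ofReal (Real.exp (-V x))) ^ p) ∧
    ((∀ i : Fin n, ∀ x' : EuclideanSpace ℝ (Fin n), x' i = 0 →
        AntitoneOn (fun t : ℝ => hessianDet (legendreReal V) (x' + t • EuclideanSpace.single i 1))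
          {t : ℝ | 0 ≤ t ∧
            HasHessianAt (legendreReal V) (x' + t • EuclideanSpace.single i 1)}) →
      ∀ Φ : EuclideanSpace ℝ (Fin n) → EReal, IsProperConvex Φ → (∀ x, Φ (-x) = Φ x) →
        blaschkeSantalo p V Φ ≤ (∫⁻ x, ENNReal.ofReal (Real.exp (-V x))) ^ p) := by
  have h := theoremA_general hp hV_hom (hV_C1.differentiable one_ne_zero) hV_unc hV_conc
  exact ⟨fun Φ _ => h.1 Φ, fun hanti Φ _ => h.2 hV_convex hV_C1 hV_C2 hanti Φ⟩
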